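/- **Setting.** There are $m\ge 1$ objects. A ranking is a permutation $\sigma$, where $\sigma(i)\in\{1,\dots,m\}$ is the rank of object $i$. Fix $n\ge 1$. For $r\in\{0,1,\dots,n\}^m$ put $$DCG(\sigma,r)=\sum_{i=1}^m\frac{2^{r(i)}-1}{\log_2(1+\sigma(i))},$$ which for binary relevance ($n=1$) is $\sum_i r(i)/\log_2(1+\sigma(i))$. An oblivious adversary fixes $r_1,\dots,r_T\in\{0,\dots,n\}^m$. In round $t$ the learner outputs a ranking $\sigma_t$, chosen from its internal randomness and the feedback of earlier rounds, and then observes only $r_t(\sigma_t^{-1}(1))$, the relevance of the object on top. The expected regret is $$\max_\sigma\sum_{t=1}^T DCG(\sigma,r_t)-\mathbb E\Big[\sum_{t=1}^T DCG(\sigma_t,r_t)\Big].$$ **Algorithm RTop-1F** (with $K\ge1$ blocks, parameter $\epsilon>0$, transformation $g$). Let $B=\lfloor T/K\rfloor\ge m$ and divide the first $KB$ rounds into $K$ consecutive blocks of length $B$. In each block, independently, draw $m$ distinct rounds $i_1,\dots,i_m$ uniformly at random without replacement. In round $i_j$ output any ranking with object $j$ on top and observe $r_{i_j}(j)$. In every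 other round $t$ draw $p_t$ uniformly from $[0,1/\epsilon]^m$ (independently of everything else) and output $\sigma_t\in\arg\min_\sigma\sum_i\sigma(i)\,(\hat s+p_t)(i)$, where $\hat s$ is the sum of the vectors $[g(r_{i_1}(1)),\dots,g(r_{i_m}(m))]$ over the blocks preceding the current one, and ties are broken arbitrarily. The fewer than $K$ rounds left over at the end are played in this second way, with $\hat s$ the sum over all blocks. **Theorem.** 1. *(Upper bound.)* There is an absolute constant $C$ such that for all $m,n\ge1$, all $T$, and all $r_1,\dots,r_T\in\{0,\dots,n\}^m$, RTop-1F with $g(v)=2^v-1$, $K=\lfloor m^{-1/3}T^{2/3}\rfloor$ and $\epsilon=\sqrt{\frac1{(2^n-1)^2mK}}$ has expected regret at most $C\,(2^n-1)\,m^{5/3}\,T^{2/3}$, provided that it can be run, i.e. $K\ge1$ and $\lfloor T/K\rfloor\ge m$; this is the case whenever $T\ge m^2$. 2. *(Binary relevance.)* In the same sense, for $r_t\in\{0,1\}^m$, RTop-1F on the untransformed relevances ($g(v)=v$) with the same $K$ and $\epsilon=\sqrt{\frac1{mK}}$ has expected regret at most $C\,m^{5/3}\,T^{2/3}$. 3.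 *(Failure of local observability.)* For all $m\ge3$ and $n\ge1$ the DCG game with top-1 feedback is not locally observable. Here $\ell_\sigma=(DCG(\sigma,r))_r\in\mathbb R^{N}$ with $N=(n+1)^m$. The cell $C_\sigma$ is the set of probability vectors $p$ with $\ell_\sigma\cdot p\ge\ell_{\sigma'}\cdot p$ for all $\sigma'$, and $\sigma$ is Pareto-optimal if $C_\sigma$ has dimension $N-1$. Distinct Pareto-optimal $\sigma,\sigma'$ are neighbors if $C_\sigma\cap C_{\sigma'}$ has dimension $N-2$, and $N^+_{\sigma,\sigma'}=\{\kappa: C_\sigma\cap C_{\sigma'}\subseteq C_\kappa\}$. The signal matrix $S_\kappa\in\{0,1\}^{(n+1)\times N}$ has entries $\mathbb 1(r(\kappa^{-1}(1))=v)$ for $v\in\{0,\dots,n\}$. Local observability means that $\ell_\sigma-\ell_{\sigma'}\in\sum_{\kappa\in N^+_{\sigma,\sigma'}}\mathrm{Col}(S_\kappa^\top)$ for all neighbors $\sigma,\sigma'$. 4. *(Lower bound.)* There is an absolute constant $c>0$ such that for all $m\ge3$, $n\ge1$, $T\ge 0$ and every (randomized) learner with top-1 feedback, there are $r_1,\dots,r_T\in\{0,\dots,n\}^m$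 against which its expected regret for DCG is at least $c\,T^{2/3}$. -/

import Mathlib

open MeasureTheory ProbabilityTheory

namespace TopOne

/-! ### Ranking measure

A ranking of the `m` objects is a permutation `σ`; the rank of object `i`, in `{1, …, m}`, is
`σ i + 1` (ranks are stored from `0`), and `σ.symm 0` is the object ranked first. -/

/-- A relevance vector with levels `{0, …, n}`. -/
abbrev Relevance (m n : ℕ) : Type := Fin m → Fin (n + 1)

/-- The rank, in `{1, …, m}`, of object `i`. -/
def rank {m : ℕ} (σ : Equiv.Perm (Fin m)) (i : Fin m) : ℕ := (σ i : ℕ) + 1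

/-- The object placed on top. -/
def topObject {m : ℕ} [NeZero m] (σ : Equiv.Perm (Fin m)) : Fin m := σ.symm 0

/-- `DCG(σ, r) = ∑ i, (2 ^ r(i) - 1) / log₂ (1 + σ(i))`. -/
noncomputable def dcg {m n : ℕ} (σ : Equiv.Perm (Fin m)) (r : Relevance m n) : ℝ :=
  ∑ i, ((2 : ℝ) ^ (r i : ℕ) - 1) / Real.logb 2 (1 + (rank σ i : ℝ))

/-- DCG for binary relevance: `∑ i, r(i) / log₂ (1 + σ(i))`. -/
noncomputable def binaryDCG {m : ℕ} (σ : Equiv.Perm (Fin m)) (r : Relevance m 1) : ℝ :=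
  ∑ i, ((r i : ℕ) : ℝ) / Real.logb 2 (1 + (rank σ i : ℝ))

/-! ### Online ranking with top-1 feedback -/

/-- A (randomized) learner for the game with `m` objects, relevance levels `{0, …, n}` and horizon
`T`. It draws its internal randomness `ω` from `μ`; in round `t` it outputs the ranking
`act ω t h`, where `h s` is the feedback received in round `s < t`. -/
structure Learner (m n T : ℕ) where
  Ω : Type
  mΩ : MeasurableSpace Ω
  μ : Measure Ω
  prob : IsProbabilityMeasure μ
  act : Ω → (t : Fin T) → (Fin (t : ℕ) → Fin (n + 1)) → Equiv.Perm (Fin m)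
  measurable_act : ∀ t h σ, MeasurableSet {ω | act ω t h = σ}

section Play

variable {m n T : ℕ} [NeZero m]

/-- The feedback received in round `t`: the relevance `r_t(σ_t⁻¹(1))` of the object placed on top,
when the deterministic strategy `a` plays against `r_1, …, r_T`. -/
def feedback (a : (t : Fin T) → (Fin (t : ℕ) → Fin (n + 1)) → Equiv.Perm (Fin m))
    (r : Fin T → Relevance m n) (t : Fin T) : Fin (n + 1) :=
  r t (topObject (a t fun s => feedback a r ⟨s, s.2.trans t.2⟩))
termination_by (t : ℕ)
decreasing_by exact s.2

/-- The ranking `σ_t` output in round `t`. -/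
def played (a : (t : Fin T) → (Fin (t : ℕ) → Fin (n + 1)) → Equiv.Perm (Fin m))
    (r : Fin T → Relevance m n) (t : Fin T) : Equiv.Perm (Fin m) :=
  a t fun s => feedback a r ⟨s, s.2.trans t.2⟩

/-- Expected regret, for a gain function, against the best fixed ranking in hindsight:
`max_σ ∑ t, gain(σ, r_t) - E [∑ t, gain(σ_t, r_t)]`. -/
noncomputable def regret (L : Learner m n T) (gain : Equiv.Perm (Fin m) → Relevance m n → ℝ)
    (r : Fin T → Relevance m n) : ℝ :=
  (Finset.univ.sup' Finset.univ_nonempty fun σ : Equiv.Perm (Fin m) => ∑ t, gain σ (r t)) -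
    ∫ ω, ∑ t, gain (played (L.act ω) r t) (r t) ∂L.μ

end Play

/-! ### Algorithm RTop-1F

The horizon is divided into `K` blocks of `T / K` (integer part) rounds. With rounds and blocks
numbered from `0`, block `k < K` consists of the rounds `k * (T / K), …, (k + 1) * (T / K) - 1`. -/

/-- A rule `M` with `M(y) ∈ argmin_σ σ · y`; ties are broken in an arbitrary (measurable) way. -/
structure ArgminRule (m : ℕ) where
  toFun : (Fin m → ℝ) → Equiv.Perm (Fin m)
  isArgmin : ∀ (y : Fin m → ℝ) (σ : Equiv.Perm (Fin m)),
    ∑ i, (rank (toFun y) i : ℝ) * y i ≤ ∑ i, (rank σ i : ℝ) * y i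
  measurable : ∀ σ, MeasurableSet {y | toFun y = σ}

section Algorithm

variable {m n T K : ℕ}

/-- The internal randomness: for each block, `m` positions inside the block, and for each round a
perturbation vector. -/
abbrev Randomness (m T K : ℕ) : Type :=
  (Fin K → Fin m → Fin (T / K)) × (Fin T → Fin m → ℝ)

/-- In each block, `m` positions drawn uniformly at random without replacement; in each round, a
vector drawn uniformly from `[0, 1/ε]^m`; all draws are independent. -/
noncomputable def randomness (m T K : ℕ) (ε : ℝ) : Measure (Randomness m T K) :=
  (Measure.pi fun _ : Fin K => uniformOn {f : Fin m → Fin (T / K) | Function.Injective f}).prod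
    (Measure.pi fun _ : Fin T => Measure.pi fun _ : Fin m => cond volume (Set.Icc (0 : ℝ) (1 / ε)))

theorem isProbabilityMeasure_randomness {ε : ℝ} (hB : m ≤ T / K) (hε : 0 < ε) :
    IsProbabilityMeasure (randomness m T K ε) := by
  have h1 : IsProbabilityMeasure (uniformOn {f : Fin m → Fin (T / K) | Function.Injective f}) :=
    isProbabilityMeasure_uniformOn (Set.toFinite _) ⟨Fin.castLE hB, Fin.castLE_injective hB⟩
  have h2 : IsProbabilityMeasure (cond (volume : Measure ℝ) (Set.Icc (0 : ℝ) (1 / ε))) := by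
    refine cond_isProbabilityMeasure_of_finite ?_ ?_
    · simp [Real.volume_Icc, hε]
    · simp [Real.volume_Icc]
  unfold randomness
  infer_instance

/-- The round at which object `j` is explored in block `k`. -/
def exploreRound (τ : Fin K → Fin m → Fin (T / K)) (k : Fin K) (j : Fin m) : ℕ :=
  (k : ℕ) * (T / K) + (τ k j : ℕ)

theorem exploreRound_lt (τ : Fin K → Fin m → Fin (T / K)) {k : Fin K} (j : Fin m) {t : ℕ}
    (hk : (k : ℕ) < t / (T / K)) : exploreRound τ k j < t := by
  have h1 : ((k : ℕ) + 1) * (T / K) ≤ t / (T / K) * (T / K) := Nat.mul_le_mul_right _ hk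
  have h2 := Nat.div_mul_le_self t (T / K)
  have h3 := (τ k j).2
  have h4 : ((k : ℕ) + 1) * (T / K) = (k : ℕ) * (T / K) + T / K := by ring
  unfold exploreRound
  omega

/-- The score vector `ŝ` used in round `t`: the sum, over the blocks that precede the block of `t`,
of the estimates `r̂_k = [g(r_{k_1}(1)), …, g(r_{k_m}(m))]`, read off from the feedback `h` of the
exploration rounds. -/
def score (g : Fin (n + 1) → ℝ) (τ : Fin K → Fin m → Fin (T / K)) (t : ℕ)
    (h : Fin t → Fin (n + 1)) (j : Fin m) : ℝ :=
  ∑ k : Fin K, if hk : (k : ℕ) < t / (T / K)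
    then g (h ⟨exploreRound τ k j, exploreRound_lt τ j hk⟩) else 0

open Classical in
/-- The ranking output in round `t`: `explore t j` if `t` is the round at which object `j` is
explored, and `M(ŝ + p_t)` otherwise. The fewer than `K` rounds left over when `K` does not divide
`T` are of the latter kind. -/
noncomputable def rtop1fAct (g : Fin (n + 1) → ℝ) (M : ArgminRule m)
    (explore : Fin T → Fin m → Equiv.Perm (Fin m)) (ω : Randomness m T K) (t : Fin T)
    (h : Fin (t : ℕ) → Fin (n + 1)) : Equiv.Perm (Fin m) :=
  if hx : ∃ kj : Fin K × Fin m, (t : ℕ) = exploreRound ω.1 kj.1 kj.2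
  then explore t hx.choose.2
  else M.toFun (score g ω.1 t h + ω.2 t)

theorem measurableSet_rtop1fAct (g : Fin (n + 1) → ℝ) (M : ArgminRule m)
    (explore : Fin T → Fin m → Equiv.Perm (Fin m)) (t : Fin T)
    (h : Fin (t : ℕ) → Fin (n + 1)) (σ : Equiv.Perm (Fin m)) :
    MeasurableSet {ω : Randomness m T K | rtop1fAct g M explore ω t h = σ} := by
  have key : {ω : Randomness m T K | rtop1fAct g M explore ω t h = σ} =
      ⋃ τ : Fin K → Fin m → Fin (T / K),
        {τ} ×ˢ {p | rtop1fAct g M explore (τ, p) t h = σ} := by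
    ext ⟨τ, p⟩
    simp
  rw [key]
  refine MeasurableSet.iUnion fun τ => (MeasurableSet.singleton τ).prod ?_
  by_cases hx : ∃ kj : Fin K × Fin m, (t : ℕ) = exploreRound τ kj.1 kj.2
  · simp only [rtop1fAct, hx, dite_true]
    exact MeasurableSet.const (explore t hx.choose.2 = σ)
  · simp only [rtop1fAct, hx, dite_false]
    have hm : Measurable fun p : Fin T → Fin m → ℝ => score g τ t h + p t := by fun_prop
    exact hm (M.measurable σ)

/-- Algorithm RTop-1F with `K` blocks and randomization parameter `ε`. The relevances enter through
the transformation `g`, and `explore t j` is the ranking played when object `j` is explored in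
round `t`. -/
noncomputable def rtop1f (g : Fin (n + 1) → ℝ) (M : ArgminRule m)
    (explore : Fin T → Fin m → Equiv.Perm (Fin m)) (K : ℕ) (ε : ℝ)
    (hB : m ≤ T / K) (hε : 0 < ε) : Learner m n T where
  Ω := Randomness m T K
  mΩ := inferInstance
  μ := randomness m T K ε
  prob := isProbabilityMeasure_randomness hB hε
  act := rtop1fAct g M explore
  measurable_act := measurableSet_rtop1fAct g M explore

/-- The number of blocks `K = m ^ (-1/3) T ^ (2/3)`, rounded down to an integer. -/
noncomputable def numBlocks (m T : ℕ) : ℕ :=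
  ⌊(m : ℝ) ^ (-(1 / 3) : ℝ) * (T : ℝ) ^ (2 / 3 : ℝ)⌋₊

end Algorithm

/-! ### Local observability of the DCG game with top-1 feedback -/

section Observability

variable {m n : ℕ}

/-- The row of the gain matrix that belongs to the learner's action `σ`. -/
noncomputable def gainRow (n : ℕ) (σ : Equiv.Perm (Fin m)) : Relevance m n → ℝ := fun r => dcg σ r

/-- The probability cell of `σ`: the distributions over outcomes under which `σ` is optimal. -/
def cell (n : ℕ) (σ : Equiv.Perm (Fin m)) : Set (Relevance m n → ℝ) :=
  {p | p ∈ stdSimplex ℝ (Relevance m n) ∧ ∀ σ', gainRow n σ' ⬝ᵥ p ≤ gainRow n σ ⬝ᵥ p}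

/-- `C` is non-empty of (affine) dimension `d`. -/
def HasDimension {E : Type*} [AddCommGroup E] [Module ℝ E] (C : Set E) (d : ℕ) : Prop :=
  C.Nonempty ∧ Module.finrank ℝ (vectorSpan ℝ C) = d

/-- The cell of `σ` has full dimension in the simplex: `(n + 1) ^ m - 1`. -/
def IsParetoOptimal (n : ℕ) (σ : Equiv.Perm (Fin m)) : Prop :=
  HasDimension (cell n σ) ((n + 1) ^ m - 1)

/-- Pareto-optimal actions whose cells meet in a set of dimension `(n + 1) ^ m - 2`. -/
def IsNeighboring (n : ℕ) (σ σ' : Equiv.Perm (Fin m)) : Prop :=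
  IsParetoOptimal n σ ∧ IsParetoOptimal n σ' ∧ σ ≠ σ' ∧
    HasDimension (cell n σ ∩ cell n σ') ((n + 1) ^ m - 2)

/-- The neighborhood action set of two actions. -/
def neighborhoodSet (n : ℕ) (σ σ' : Equiv.Perm (Fin m)) : Set (Equiv.Perm (Fin m)) :=
  {κ | cell n σ ∩ cell n σ' ⊆ cell n κ}

/-- The signal matrix of `σ`: the entry in row `v` and column `r` is `1` if the feedback of `σ` under
the outcome `r` is `v`, and `0` otherwise. -/
def signalMatrix [NeZero m] (n : ℕ) (σ : Equiv.Perm (Fin m)) :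
    Matrix (Fin (n + 1)) (Relevance m n) ℝ :=
  Matrix.of fun v r => if r (topObject σ) = v then 1 else 0

/-- For every pair of neighboring actions, the difference of their rows lies in the sum of the column
spaces of the transposed signal matrices of the actions in their neighborhood action set. -/
def LocallyObservable (m n : ℕ) [NeZero m] : Prop :=
  ∀ σ σ' : Equiv.Perm (Fin m), IsNeighboring n σ σ' →
    gainRow n σ - gainRow n σ' ∈
      ⨆ κ ∈ neighborhoodSet n σ σ',
        LinearMap.range (Matrix.mulVecLin (Matrix.transpose (signalMatrix n κ)))

end Observability

end TopOne

/-! DCG is linear: `DCG(σ, r) = d_σ ⬝ᵥ g(r)` with the discount vector `d_σ ∈ [0, 1]^m`, and by the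
rearrangement inequality a ranking maximizes `d_σ ⬝ᵥ y` exactly if it sorts `y` in decreasing order.

*Upper bound.* The positions explored in a block are uniform and independent of the earlier blocks,
so up to the factor `T / K` the expected gain of the perturbed leader in a block is its gain on the
estimate `r̂_k`. Against the estimates, being the leader one step ahead costs no regret apart from
the range `m / ε` of the perturbation, and a translation of the uniform cube `[0, 1/ε]^m` by `r̂_k`
changes the expected gain by at most `ε (m G)^2`. The `K m` exploration rounds and the fewer than
`K` rounds left over cost at most `m G` each; the choice of `K` and `ε` balances these terms.

*Failure of local observability.* The cells of two rankings that exchange objects of adjacent ranks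
share a facet; at its generic points the only tie of expected gains is the one between these two
objects. If the ranks are `2` and `3`, every action whose cell contains the facet has the same
object on top, and the relevance of that object alone does not determine the difference of the two
rows.

*Lower bound.* Object `0` is always relevant, and so is one of the objects `1` and `2`, according to
a coin of bias `1/2 + δ` or `1/2 - δ`. Only rankings with object `1` or `2` on top reveal the coin,
and they lose a constant. Weight the two hypotheses by `u` and `v`: a round without observation
costs at least a multiple of `δ` times the parallel sum `u v / (u + v)`, while an observation leaves
at least the fraction `1 - 4 δ ^ 2` of this potential. With `δ` of the order of `T ^ (-1/3)`
neither confusing the two coins nor telling them apart is cheaper than a multiple of `T ^ (2/3)`.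
-/

namespace TopOne

/-! ### Discounts and the rearrangement inequality -/

section Rearrangement

variable {ι R : Type*} [Fintype ι] [CommRing R]

theorem comp_swap_dotProduct [DecidableEq ι] (f y : ι → R) (i j : ι) :
    (f ∘ Equiv.swap i j) ⬝ᵥ y = f ⬝ᵥ y + (f j - f i) * (y i - y j) := by
  rcases eq_or_ne i j with rfl | hij
  · simp
  rw [← sub_eq_iff_eq_add', ← sub_dotProduct, dotProduct, Fintype.sum_eq_add i j hij]
  · simp only [Pi.sub_apply, Function.comp_apply, Equiv.swap_apply_left, Equiv.swap_apply_right]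
    ring
  · rintro k ⟨hki, hkj⟩
    simp [Equiv.swap_apply_of_ne_of_ne hki hkj]

variable [LinearOrder R] [IsStrictOrderedRing R] [LinearOrder ι]

theorem comp_perm_dotProduct_le {w : ι → R} (hw : Antitone w) {σ : Equiv.Perm ι} {y : ι → R}
    (h : ∀ i j, σ i < σ j → y j ≤ y i) (σ' : Equiv.Perm ι) :
    (w ∘ σ') ⬝ᵥ y ≤ (w ∘ σ) ⬝ᵥ y := by
  have hmono : Monovary (w ∘ σ) y := fun i j hij =>
    hw <| not_lt.1 fun hlt => hij.not_ge (h i j hlt)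
  simpa [dotProduct] using hmono.sum_comp_perm_mul_le_sum_mul (σ := σ'.trans σ.symm)

theorem forall_comp_perm_dotProduct_le_iff {w : ι → R} (hw : StrictAnti w) {σ : Equiv.Perm ι}
    {y : ι → R} :
    (∀ σ' : Equiv.Perm ι, (w ∘ σ') ⬝ᵥ y ≤ (w ∘ σ) ⬝ᵥ y) ↔ ∀ i j, σ i < σ j → y j ≤ y i := by
  refine ⟨fun h i j hij => ?_, comp_perm_dotProduct_le hw.antitone⟩
  have hswap := h (σ * Equiv.swap i j)
  rw [Equiv.Perm.coe_mul, ← Function.comp_assoc, comp_swap_dotProduct] at hswap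
  exact le_of_not_gt fun hlt =>
    (mul_pos_of_neg_of_neg (sub_neg.2 (hw hij)) (sub_neg.2 hlt)).not_ge (by simpa using hswap)

end Rearrangement

section Discount

/-- The weight `1 / log₂ (1 + ρ)` that DCG gives to the rank `ρ = k + 1`. -/
noncomputable def discount (k : ℕ) : ℝ := 1 / Real.logb 2 (k + 2)

theorem one_le_logb_two_add_two (k : ℕ) : 1 ≤ Real.logb 2 (k + 2) := by
  rw [Real.le_logb_iff_rpow_le one_lt_two (by positivity), Real.rpow_one]
  linarith [k.cast_nonneg (α := ℝ)]

theorem discount_pos (k : ℕ) : 0 < discount k :=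
  one_div_pos.2 (one_pos.trans_le (one_le_logb_two_add_two k))

theorem discount_le_one (k : ℕ) : discount k ≤ 1 :=
  div_le_one_of_le₀ (one_le_logb_two_add_two k) (zero_le_one.trans (one_le_logb_two_add_two k))

theorem discount_strictAnti : StrictAnti discount := fun a b hab =>
  one_div_lt_one_div_of_lt (one_pos.trans_le (one_le_logb_two_add_two a))
    (Real.logb_lt_logb one_lt_two (by positivity) (by gcongr))

theorem discount_zero : discount 0 = 1 := by
  norm_num [discount]

theorem discount_two : discount 2 = 1 / 2 := by
  rw [discount, show ((2 : ℕ) : ℝ) + 2 = 2 ^ 2 by norm_num, Real.logb_pow]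
  norm_num

/-- These are the comparisons `2 ^ 3 ≤ 3 ^ 2` and `3 ^ 5 ≤ 2 ^ 8`. -/
theorem discount_one_mem_Icc : discount 1 ∈ Set.Icc (5 / 8 : ℝ) (2 / 3) := by
  have hlower : Real.logb 2 (2 ^ 3) ≤ Real.logb 2 (3 ^ 2) :=
    Real.logb_le_logb_of_le one_lt_two (by norm_num) (by norm_num)
  have hupper : Real.logb 2 (3 ^ 5) ≤ Real.logb 2 (2 ^ 8) :=
    Real.logb_le_logb_of_le one_lt_two (by norm_num) (by norm_num)
  simp only [Real.logb_pow, Real.logb_self_eq_one one_lt_two] at hlower hupper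
  norm_num at hlower hupper
  rw [discount, show ((1 : ℕ) : ℝ) + 2 = 3 by norm_num, Set.mem_Icc,
    le_div_iff₀ (by linarith), div_le_iff₀ (by linarith)]
  constructor <;> linarith

variable {m n : ℕ}

/-- The weights that DCG gives to the objects under the ranking `σ`. -/
noncomputable def discountVector (σ : Equiv.Perm (Fin m)) : Fin m → ℝ :=
  (fun k : Fin m => discount k) ∘ σ

/-- The gains `2 ^ r(i) - 1` of the objects. -/
def relevanceGain (r : Relevance m n) : Fin m → ℝ := fun i => 2 ^ (r i : ℕ) - 1

theorem strictAnti_discount_val : StrictAnti fun k : Fin m => discount k :=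
  discount_strictAnti.comp_strictMono Fin.val_strictMono

theorem discountVector_apply (σ : Equiv.Perm (Fin m)) (i : Fin m) :
    discountVector σ i = discount (σ i) := rfl

theorem discountVector_mem_Icc (σ : Equiv.Perm (Fin m)) : discountVector σ ∈ Set.Icc 0 1 :=
  ⟨fun _ => (discount_pos _).le, fun _ => discount_le_one _⟩

theorem range_discountVector_subset :
    Set.range (discountVector (m := m)) ⊆ Set.Icc 0 1 :=
  Set.range_subset_iff.2 discountVector_mem_Icc

theorem discountVector_mul_swap_dotProduct (σ : Equiv.Perm (Fin m)) (a b : Fin m)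
    (y : Fin m → ℝ) :
    discountVector (σ * Equiv.swap a b) ⬝ᵥ y =
      discountVector σ ⬝ᵥ y + (discount (σ b) - discount (σ a)) * (y a - y b) :=
  comp_swap_dotProduct (discountVector σ) y a b

theorem dcg_eq_dotProduct (σ : Equiv.Perm (Fin m)) (r : Relevance m n) :
    dcg σ r = discountVector σ ⬝ᵥ relevanceGain r := by
  refine Finset.sum_congr rfl fun i _ => ?_
  simp only [discountVector_apply, relevanceGain, discount, rank]
  push_cast
  ring_nf

theorem binaryDCG_eq_dotProduct (σ : Equiv.Perm (Fin m)) (r : Relevance m 1) :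
    binaryDCG σ r = discountVector σ ⬝ᵥ fun i => ((r i : ℕ) : ℝ) := by
  refine Finset.sum_congr rfl fun i _ => ?_
  simp only [discountVector_apply, discount, rank]
  push_cast
  ring_nf

end Discount

/-! ### Cells of the DCG game -/

section Dimension

variable {E F : Type*} [AddCommGroup E] [Module ℝ E] [TopologicalSpace E] [ContinuousAdd E]
  [ContinuousSMul ℝ E] [AddCommGroup F] [Module ℝ F]

theorem vectorSpan_eq_ker_of_isOpen {L : E →ₗ[ℝ] F} {C U : Set E} {p : E} (hU : IsOpen U)
    (hp : p ∈ U) (hC : ∀ x ∈ C, L x = L p) (hUC : ∀ x ∈ U, L x = L p → x ∈ C) :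
    vectorSpan ℝ C = LinearMap.ker L := by
  apply le_antisymm
  · rw [vectorSpan_def, Submodule.span_le]
    rintro _ ⟨x, hx, y, hy, rfl⟩
    simp [hC x hx, hC y hy]
  · intro v hv
    have hcont : Continuous fun s : ℝ => p + s • v := by fun_prop
    have hnear : ∀ᶠ s : ℝ in nhds 0, p + s • v ∈ U :=
      hcont.continuousAt.eventually (hU.mem_nhds (by simpa using hp))
    obtain ⟨s, hsU, hs⟩ := ((hnear.filter_mono nhdsWithin_le_nhds).and
      (self_mem_nhdsWithin (a := (0 : ℝ)) (s := {0}ᶜ))).exists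
    have hmem : p + s • v ∈ C := hUC _ hsU (by simp [LinearMap.mem_ker.1 hv])
    have hspan : s • v ∈ vectorSpan ℝ C := by
      simpa using vsub_mem_vectorSpan ℝ hmem (hUC p hp rfl)
    exact (Submodule.smul_mem_iff _ hs).1 hspan

theorem hasDimension_of_isOpen [FiniteDimensional ℝ E] {L : E →ₗ[ℝ] F}
    (hL : Function.Surjective L) {C U : Set E} {p : E} (hU : IsOpen U) (hp : p ∈ U)
    (hC : ∀ x ∈ C, L x = L p) (hUC : ∀ x ∈ U, L x = L p → x ∈ C) :
    HasDimension C (Module.finrank ℝ E - Module.finrank ℝ F) := by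
  refine ⟨⟨p, hUC p hp rfl⟩, ?_⟩
  have hrank := L.finrank_range_add_finrank_ker
  rw [LinearMap.range_eq_top.2 hL, finrank_top] at hrank
  rw [vectorSpan_eq_ker_of_isOpen hU hp hC hUC]
  omega

end Dimension

section MeanGain

variable {m n : ℕ}

theorem two_pow_sub_one_pos (hn : 1 ≤ n) : (0 : ℝ) < 2 ^ n - 1 :=
  sub_pos.2 (one_lt_pow₀ one_lt_two (Nat.one_le_iff_ne_zero.1 hn))

/-- The expected gains of the objects, as a function of the distribution of the outcome. -/
def meanGain (m n : ℕ) : (Relevance m n → ℝ) →ₗ[ℝ] (Fin m → ℝ) :=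
  (Matrix.of fun i r => relevanceGain r i).mulVecLin

theorem gainRow_dotProduct (σ : Equiv.Perm (Fin m)) (p : Relevance m n → ℝ) :
    gainRow n σ ⬝ᵥ p = discountVector σ ⬝ᵥ meanGain m n p := by
  have hrow : gainRow n σ = Matrix.vecMul (discountVector σ)
      (Matrix.of fun i (r : Relevance m n) => relevanceGain r i) :=
    funext fun r => dcg_eq_dotProduct σ r
  rw [hrow, meanGain, Matrix.mulVecLin_apply, Matrix.dotProduct_mulVec]

theorem mem_cell_iff {σ : Equiv.Perm (Fin m)} {p : Relevance m n → ℝ} :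
    p ∈ cell n σ ↔ p ∈ stdSimplex ℝ (Relevance m n) ∧
      ∀ i j, σ i < σ j → meanGain m n p j ≤ meanGain m n p i := by
  rw [← forall_comp_perm_dotProduct_le_iff strictAnti_discount_val]
  simp only [cell, Set.mem_ofPred_eq, gainRow_dotProduct, discountVector]

theorem meanGain_single (r : Relevance m n) (x : ℝ) :
    meanGain m n (Pi.single r x) = x • relevanceGain r := by
  ext i
  simp [meanGain, mul_comm]

theorem meanGain_one_apply_eq (i j : Fin m) : meanGain m n 1 i = meanGain m n 1 j := by
  simp only [meanGain, Matrix.mulVecLin_apply, Matrix.mulVec, dotProduct_one, Matrix.of_apply,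
    relevanceGain]
  exact Fintype.sum_equiv ((Equiv.swap i j).arrowCongr (Equiv.refl _)) _ _ fun r => by simp

/-- The outcome in which only the object `o` is relevant, at the highest level. -/
def onlyRelevant (n : ℕ) (o : Fin m) : Relevance m n := Pi.single o (Fin.last n)

theorem relevanceGain_zero : relevanceGain (0 : Relevance m n) = 0 := by
  ext i
  simp [relevanceGain]

theorem relevanceGain_onlyRelevant (o : Fin m) :
    relevanceGain (onlyRelevant n o) = Pi.single o (2 ^ n - 1) := by
  ext i
  rcases eq_or_ne i o with rfl | h
  · simp [relevanceGain, onlyRelevant]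
  · simp [relevanceGain, onlyRelevant, h]

theorem exists_distribution_meanGain_le_iff (hn : 1 ≤ n) (c : Fin m → ℝ) :
    ∃ p : Relevance m n → ℝ, (∀ r, 0 < p r) ∧ ∑ r, p r = 1 ∧
      ∀ i j, meanGain m n p i ≤ meanGain m n p j ↔ c i ≤ c j := by
  set w : Relevance m n → ℝ := 1 + ∑ o, Pi.single (onlyRelevant n o) (Real.exp (c o)) with hw
  have hw_pos : ∀ r, 0 < w r := fun r => by
    have : 0 ≤ (∑ o, Pi.single (onlyRelevant n o) (Real.exp (c o)) : Relevance m n → ℝ) :=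
      Finset.sum_nonneg fun o _ => Pi.single_nonneg.2 (Real.exp_pos _).le
    exact add_pos_of_pos_of_nonneg one_pos (this r)
  have hsum_pos : 0 < ∑ r, w r := Finset.sum_pos (fun r _ => hw_pos r) Finset.univ_nonempty
  have hmean : ∀ i, meanGain m n w i = meanGain m n 1 i + Real.exp (c i) * (2 ^ n - 1) := by
    intro i
    simp only [hw, map_add, map_sum, meanGain_single, relevanceGain_onlyRelevant, Pi.add_apply,
      Finset.sum_apply, Pi.smul_apply, smul_eq_mul, Pi.single_apply, mul_ite, mul_zero,
      Finset.sum_ite_eq, Finset.mem_univ, if_true]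
  refine ⟨(∑ r, w r)⁻¹ • w, fun r => mul_pos (inv_pos.2 hsum_pos) (hw_pos r), ?_, fun i j => ?_⟩
  · simp only [Pi.smul_apply, smul_eq_mul, ← Finset.mul_sum, inv_mul_cancel₀ hsum_pos.ne']
  · rw [map_smul, Pi.smul_apply, Pi.smul_apply, smul_eq_mul, smul_eq_mul,
      mul_le_mul_iff_right₀ (inv_pos.2 hsum_pos), hmean, hmean, meanGain_one_apply_eq i j,
      add_le_add_iff_left, mul_le_mul_iff_left₀ (two_pow_sub_one_pos hn), Real.exp_le_exp]

end MeanGain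

section Cells

variable {m n : ℕ}

/-- The positive vectors whose expected gains satisfy the strict comparisons prescribed by `R`. -/
def strictRegion (n : ℕ) (R : Fin m → Fin m → Prop) : Set (Relevance m n → ℝ) :=
  {p | (∀ r, 0 < p r) ∧ ∀ i j, R i j → meanGain m n p j < meanGain m n p i}

theorem isOpen_strictRegion (R : Fin m → Fin m → Prop) : IsOpen (strictRegion n R) := by
  have hcont : ∀ i, Continuous fun p : Relevance m n → ℝ => meanGain m n p i := fun i =>
    (continuous_apply i).comp (LinearMap.continuous_of_finiteDimensional _)
  simp only [strictRegion, Set.ofPred_and, Set.ofPred_forall]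
  exact (isOpen_iInter_of_finite fun r => isOpen_lt continuous_const (continuous_apply r)).inter <|
    isOpen_iInter_of_finite fun i => isOpen_iInter_of_finite fun j =>
      isOpen_iInter_of_finite fun _ => isOpen_lt (hcont j) (hcont i)

/-- The linear form `p ↦ ∑ r, p r`, equal to `1` on the distributions. -/
def totalMass (m n : ℕ) : (Relevance m n → ℝ) →ₗ[ℝ] ℝ := ∑ r, LinearMap.proj r

theorem totalMass_apply (p : Relevance m n → ℝ) : totalMass m n p = ∑ r, p r := by
  simp [totalMass]

theorem isParetoOptimal (hn : 1 ≤ n) (σ : Equiv.Perm (Fin m)) : IsParetoOptimal n σ := by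
  obtain ⟨p, hpos, hsum, hle⟩ :=
    exists_distribution_meanGain_le_iff hn fun i : Fin m => -((σ i : ℕ) : ℝ)
  have hp : p ∈ strictRegion n fun i j => σ i < σ j :=
    ⟨hpos, fun i j hij => not_le.1 ((hle i j).not.2 (by simpa using hij))⟩
  have hsurj : Function.Surjective (totalMass m n) := fun x =>
    ⟨Pi.single 0 x, by simp [totalMass_apply]⟩
  simpa using! hasDimension_of_isOpen (C := cell n σ) hsurj (isOpen_strictRegion _) hp
    (fun x hx => by rw [totalMass_apply, totalMass_apply, hsum, hx.1.2])
    fun x hx hmass => mem_cell_iff.2 ⟨⟨fun r => (hx.1 r).le, by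
      rw [← totalMass_apply, hmass, totalMass_apply, hsum]⟩, fun i j hij => (hx.2 i j hij).le⟩

/-- Total mass and the difference of the expected gains of `a` and `b`: the two linear forms that
are constant on the common boundary of two cells that differ by exchanging `a` and `b`. -/
def massAndGap (n : ℕ) (a b : Fin m) : (Relevance m n → ℝ) →ₗ[ℝ] ℝ × ℝ :=
  (totalMass m n).prod (LinearMap.proj a ∘ₗ meanGain m n - LinearMap.proj b ∘ₗ meanGain m n)

theorem massAndGap_apply (a b : Fin m) (p : Relevance m n → ℝ) :
    massAndGap n a b p = (∑ r, p r, meanGain m n p a - meanGain m n p b) := by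
  simp [massAndGap, totalMass_apply]

theorem massAndGap_surjective (hn : 1 ≤ n) {a b : Fin m} (hab : a ≠ b) :
    Function.Surjective (massAndGap n a b) := by
  rintro ⟨x, y⟩
  have hgain := (two_pow_sub_one_pos hn).ne'
  refine ⟨Pi.single 0 (x - y / (2 ^ n - 1)) + Pi.single (onlyRelevant n a) (y / (2 ^ n - 1)), ?_⟩
  simp [massAndGap_apply, meanGain_single, relevanceGain_zero, relevanceGain_onlyRelevant,
    Finset.sum_add_distrib, hab.symm, div_mul_cancel₀ _ hgain]

section Adjacent

variable {σ : Equiv.Perm (Fin m)} {a b : Fin m}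

theorem mul_swap_apply_lt_iff (hab : (σ b : ℕ) = σ a + 1) {i j : Fin m} (hij : ¬(i = a ∧ j = b))
    (hji : ¬(i = b ∧ j = a)) :
    (σ * Equiv.swap a b) i < (σ * Equiv.swap a b) j ↔ σ i < σ j := by
  rw [← σ.injective.eq_iff, ← σ.injective.eq_iff (a := j)] at hij hji
  rw [Equiv.mul_swap_eq_swap_mul]
  simp only [Equiv.Perm.mul_apply, Equiv.swap_apply_def, Fin.ext_iff, Fin.lt_def] at *
  split_ifs <;> omega

theorem mem_cell_inter_cell_mul_swap_iff (hab : (σ b : ℕ) = σ a + 1) {p : Relevance m n → ℝ} :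
    p ∈ cell n σ ∩ cell n (σ * Equiv.swap a b) ↔
      p ∈ cell n σ ∧ meanGain m n p a = meanGain m n p b := by
  have hlt : σ a < σ b := Fin.lt_def.2 (by omega)
  simp only [Set.mem_inter_iff, mem_cell_iff]
  refine ⟨fun ⟨h, h'⟩ => ⟨h, ?_⟩, fun ⟨h, heq⟩ => ⟨h, h.1, fun i j hij => ?_⟩⟩
  · exact (h'.2 b a (by simpa using hlt)).antisymm (h.2 a b hlt)
  · by_cases h₁ : i = a ∧ j = b
    · rw [h₁.1, h₁.2, heq]
    by_cases h₂ : i = b ∧ j = a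
    · rw [h₂.1, h₂.2, heq]
    exact h.2 i j ((mul_swap_apply_lt_iff hab h₁ h₂).1 hij)

theorem exists_mem_strictRegion_of_adjacent (hn : 1 ≤ n) (hab : (σ b : ℕ) = σ a + 1) :
    ∃ p ∈ strictRegion n fun i j => σ i < σ j ∧ ¬(i = a ∧ j = b),
      ∑ r, p r = 1 ∧ meanGain m n p a = meanGain m n p b := by
  obtain ⟨p, hpos, hsum, hle⟩ := exists_distribution_meanGain_le_iff hn
    fun i : Fin m => -(((if σ i = σ b then σ a else σ i : Fin m) : ℕ) : ℝ)
  refine ⟨p, ⟨hpos, fun i j ⟨hlt, hij⟩ => not_le.1 ((hle i j).not.2 ?_)⟩, hsum,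
    ((hle a b).2 ?_).antisymm ((hle b a).2 ?_)⟩
  · rw [← σ.injective.eq_iff, ← σ.injective.eq_iff (a := j)] at hij
    rw [neg_le_neg_iff, Nat.cast_le]
    simp only [Fin.ext_iff, Fin.lt_def] at *
    split_ifs <;> omega
  all_goals simp

theorem isNeighboring_mul_swap (hn : 1 ≤ n) (hab : (σ b : ℕ) = σ a + 1) :
    IsNeighboring n σ (σ * Equiv.swap a b) := by
  have hne : a ≠ b := by rintro rfl; omega
  refine ⟨isParetoOptimal hn _, isParetoOptimal hn _,
    by simpa [Equiv.swap_eq_one_iff] using hne, ?_⟩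
  obtain ⟨p, hp, hsum, hgap⟩ := exists_mem_strictRegion_of_adjacent hn hab
  simpa using! hasDimension_of_isOpen (C := cell n σ ∩ cell n (σ * Equiv.swap a b))
    (massAndGap_surjective hn hne) (isOpen_strictRegion _) hp
    (fun x hx => by
      obtain ⟨hx, hxab⟩ := (mem_cell_inter_cell_mul_swap_iff hab).1 hx
      simp [massAndGap_apply, hsum, hgap, hx.1.2, hxab])
    fun x hx hL => by
      simp only [massAndGap_apply, hsum, hgap, Prod.mk.injEq, sub_self, sub_eq_zero] at hL
      refine (mem_cell_inter_cell_mul_swap_iff hab).2 ⟨mem_cell_iff.2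
        ⟨⟨fun r => (hx.1 r).le, hL.1⟩, fun i j hij => ?_⟩, hL.2⟩
      by_cases h : i = a ∧ j = b
      · rw [h.1, h.2, hL.2]
      · exact (hx.2 i j ⟨hij, h⟩).le

end Adjacent

variable [NeZero m]

theorem topObject_eq_iff {σ : Equiv.Perm (Fin m)} {o : Fin m} : topObject σ = o ↔ σ o = 0 := by
  rw [topObject, Equiv.symm_apply_eq, eq_comm]

theorem single_onlyRelevant_mem_cell_iff (hn : 1 ≤ n) {σ : Equiv.Perm (Fin m)} {o : Fin m} :
    Pi.single (onlyRelevant n o) 1 ∈ cell n σ ↔ topObject σ = o := by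
  rw [mem_cell_iff, topObject_eq_iff, meanGain_single, one_smul, relevanceGain_onlyRelevant,
    and_iff_right (single_mem_stdSimplex ℝ _)]
  constructor
  · intro h
    by_contra hne
    have hlt : σ (topObject σ) < σ o := by
      simpa [topObject] using Fin.pos_iff_ne_zero.2 hne
    have hle := h _ _ hlt
    rw [Pi.single_eq_same, Pi.single_eq_of_ne (fun heq => hne (topObject_eq_iff.1 heq))] at hle
    exact (two_pow_sub_one_pos hn).not_ge hle
  · intro ho i j hij
    have hj : j ≠ o := by
      rintro rfl
      simp [ho] at hij
    rw [Pi.single_eq_of_ne hj]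
    have hnonneg : (0 : Fin m → ℝ) ≤ Pi.single o (2 ^ n - 1) :=
      Pi.single_nonneg.2 (two_pow_sub_one_pos hn).le
    exact hnonneg i

theorem topObject_eq_of_mem_neighborhoodSet (hn : 1 ≤ n) {σ σ' κ : Equiv.Perm (Fin m)}
    (h : topObject σ' = topObject σ) (hκ : κ ∈ neighborhoodSet n σ σ') :
    topObject κ = topObject σ :=
  (single_onlyRelevant_mem_cell_iff hn).1 <|
    hκ ⟨(single_onlyRelevant_mem_cell_iff hn).2 rfl, (single_onlyRelevant_mem_cell_iff hn).2 h⟩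

theorem mulVecLin_transpose_signalMatrix (κ : Equiv.Perm (Fin m)) :
    (signalMatrix n κ).transpose.mulVecLin =
      LinearMap.funLeft ℝ ℝ fun r : Relevance m n => r (topObject κ) := by
  ext x r
  simp [signalMatrix, LinearMap.funLeft_apply, Pi.single_apply]

/-- Two rankings that differ below the top position are separated by the order of two objects, but
every action in their neighborhood action set reveals the relevance of their common top object
only. -/
theorem not_locallyObservable (hm : 3 ≤ m) (hn : 1 ≤ n) : ¬ LocallyObservable m n := by
  intro hobs
  set a : Fin m := ⟨1, by omega⟩ with ha
  set b : Fin m := ⟨2, by omega⟩ with hb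
  have htop : topObject (Equiv.swap a b) = 0 :=
    topObject_eq_iff.2 <|
      Equiv.swap_apply_of_ne_of_ne (by simp [ha, Fin.ext_iff]) (by simp [hb, Fin.ext_iff])
  have hle : ⨆ κ ∈ neighborhoodSet n 1 (Equiv.swap a b),
      LinearMap.range (signalMatrix n κ).transpose.mulVecLin ≤
      LinearMap.range (LinearMap.funLeft ℝ ℝ fun r : Relevance m n => r 0) :=
    iSup₂_le fun κ hκ => by
      rw [mulVecLin_transpose_signalMatrix, topObject_eq_of_mem_neighborhoodSet hn htop hκ]
      rfl
  have hneighbor : IsNeighboring n 1 (Equiv.swap a b) := isNeighboring_mul_swap hn rfl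
  obtain ⟨f, hf⟩ := hle (hobs 1 (Equiv.swap a b) hneighbor)
  have hrow : ∀ r : Relevance m n, f (r 0) =
      (discount 1 - discount 2) * (relevanceGain r a - relevanceGain r b) := fun r => by
    have hfr : f (r 0) = dcg 1 r - dcg (Equiv.swap a b) r := congrFun hf r
    have hswap := discountVector_mul_swap_dotProduct 1 a b (relevanceGain r)
    rw [one_mul] at hswap
    rw [hfr, dcg_eq_dotProduct, dcg_eq_dotProduct, hswap]
    simp only [Equiv.Perm.coe_one, id_eq, ha, hb]
    ring
  have hlevel : onlyRelevant n a 0 = (0 : Relevance m n) 0 :=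
    Pi.single_eq_of_ne (by simp [ha, Fin.ext_iff]) _
  have hba : b ≠ a := by simp [ha, hb]
  have hone := hrow (onlyRelevant n a)
  rw [hlevel, hrow 0, relevanceGain_zero, relevanceGain_onlyRelevant, Pi.single_eq_same,
    Pi.single_eq_of_ne hba, Pi.zero_apply, Pi.zero_apply, sub_zero, sub_zero, mul_zero] at hone
  exact (mul_pos (sub_pos.2 (discount_strictAnti one_lt_two)) (two_pow_sub_one_pos hn)).ne hone

end Cells

/-! ### The play of a strategy -/

section Play

/-- A deterministic learner: the ranking output in each round, given the earlier feedback. -/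
abbrev Strategy (m n T : ℕ) : Type :=
  (t : Fin T) → (Fin (t : ℕ) → Fin (n + 1)) → Equiv.Perm (Fin m)

variable {m n T : ℕ} [NeZero m]

theorem feedback_eq (a : Strategy m n T) (r : Fin T → Relevance m n) (t : Fin T) :
    feedback a r t = r t (topObject (played a r t)) := by
  rw [feedback, played]

theorem played_eq_iff (a : Strategy m n T) (r : Fin T → Relevance m n) (t : Fin T)
    (σ : Equiv.Perm (Fin m)) :
    played a r t = σ ↔
      ∃ h, a t h = σ ∧ ∀ s : Fin t, feedback a r ⟨s, s.2.trans t.2⟩ = h s := by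
  constructor
  · exact fun h => ⟨_, h, fun _ => rfl⟩
  · rintro ⟨h, rfl, hfeedback⟩
    exact congrArg (a t) (funext hfeedback)

theorem measurableSet_played (L : Learner m n T) (r : Fin T → Relevance m n) (t : Fin T)
    (σ : Equiv.Perm (Fin m)) : MeasurableSet[L.mΩ] {ω | played (L.act ω) r t = σ} := by
  let _ := L.mΩ
  obtain ⟨t, ht⟩ := t
  induction t using Nat.strong_induction_on generalizing σ with
  | _ t ih =>
  have hfeedback (s : Fin t) (v : Fin (n + 1)) :
      MeasurableSet {ω | feedback (L.act ω) r ⟨s, s.2.trans ht⟩ = v} := by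
    have heq : {ω | feedback (L.act ω) r ⟨s, s.2.trans ht⟩ = v} =
        ⋃ σ ∈ {σ | r ⟨s, s.2.trans ht⟩ (topObject σ) = v},
          {ω | played (L.act ω) r ⟨s, s.2.trans ht⟩ = σ} := by
      ext ω
      simp [feedback_eq]
    rw [heq]
    exact MeasurableSet.biUnion (Set.to_countable _) fun σ _ => ih s s.2 σ _
  simp only [played_eq_iff, Set.ofPred_exists, Set.ofPred_and, Set.ofPred_forall]
  exact MeasurableSet.iUnion fun h =>
    (L.measurable_act _ _ _).inter (MeasurableSet.iInter fun s => hfeedback s _)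

theorem integrable_played (L : Learner m n T) (r : Fin T → Relevance m n) (t : Fin T)
    (F : Equiv.Perm (Fin m) → ℝ) :
    @Integrable _ _ _ _ L.mΩ (fun ω => F (played (L.act ω) r t)) L.μ := by
  let _ := L.mΩ
  have := L.prob
  let _ : MeasurableSpace (Equiv.Perm (Fin m)) := ⊤
  have hmeas : Measurable fun ω => played (L.act ω) r t :=
    measurable_to_countable' fun σ => measurableSet_played L r t σ
  exact Integrable.of_bound ((measurable_from_top (f := F)).comp hmeas).aestronglyMeasurable
    (∑ σ, |F σ|) (.of_forall fun ω =>
      Finset.single_le_sum (f := fun σ => |F σ|) (fun _ _ => abs_nonneg _) (Finset.mem_univ _))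

theorem integral_sum_sub_played_le_regret (L : Learner m n T)
    (gain : Equiv.Perm (Fin m) → Relevance m n → ℝ) (r : Fin T → Relevance m n)
    (σ : Equiv.Perm (Fin m)) :
    ∫ ω, ∑ t, (gain σ (r t) - gain (played (L.act ω) r t) (r t)) ∂L.μ ≤ regret L gain r := by
  let _ := L.mΩ
  have := L.prob
  simp only [Finset.sum_sub_distrib]
  rw [integral_sub (integrable_const _) (integrable_finsetSum _ fun t _ =>
    integrable_played L r t fun σ => gain σ (r t)), integral_const, probReal_univ, one_smul]
  exact sub_le_sub_right (Finset.le_sup' (fun σ => ∑ t, gain σ (r t)) (Finset.mem_univ σ)) _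

/-- The strategy that remains after the first round, in which the feedback was `v`. -/
def tailStrategy (a : Strategy m n (T + 1)) (v : Fin (n + 1)) : Strategy m n T :=
  fun t h => a t.succ (Fin.cons (α := fun _ => Fin (n + 1)) v h)

theorem played_zero (a : Strategy m n (T + 1)) (r : Fin (T + 1) → Relevance m n) :
    played a r 0 = a 0 Fin.elim0 :=
  congrArg (a 0) (funext fun s => s.elim0)

theorem played_succ (a : Strategy m n (T + 1)) (r₀ : Relevance m n) (r : Fin T → Relevance m n)
    (t : Fin T) :
    played a (Fin.cons r₀ r) t.succ =
      played (tailStrategy a (r₀ (topObject (a 0 Fin.elim0)))) r t := by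
  obtain ⟨t, ht⟩ := t
  induction t using Nat.strong_induction_on with
  | _ t ih =>
  refine congrArg (a _) (funext fun s => ?_)
  refine Fin.cases ?_ (fun s => ?_) s
  · change feedback a (Fin.cons r₀ r) 0 = _
    rw [feedback_eq, played_zero, Fin.cons_zero, Fin.cons_zero]
  · change feedback a (Fin.cons r₀ r) (Fin.succ ⟨s, s.2.trans ht⟩) = _
    rw [feedback_eq, ih s s.2 (s.2.trans ht), Fin.cons_succ, Fin.cons_succ, feedback_eq]

end Play

/-! ### A two-point Bayesian lower bound -/

section ParallelSum

/-- The parallel sum `1 / (1 / u + 1 / v)`, the potential of a learner that gives the weights `u`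
and `v` to two hypotheses. In the form chosen here it is `0` at `u = v = 0`. -/
noncomputable def parallelSum (u v : ℝ) : ℝ := u * v / (u + v)

variable {u v : ℝ}

theorem parallelSum_comm (u v : ℝ) : parallelSum u v = parallelSum v u := by
  rw [parallelSum, parallelSum, mul_comm, add_comm]

theorem parallelSum_nonneg (hu : 0 ≤ u) (hv : 0 ≤ v) : 0 ≤ parallelSum u v :=
  div_nonneg (mul_nonneg hu hv) (add_nonneg hu hv)

theorem parallelSum_le_left (hu : 0 ≤ u) (hv : 0 ≤ v) : parallelSum u v ≤ u :=
  div_le_of_le_mul₀ (add_nonneg hu hv) hu (by nlinarith [sq_nonneg u])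

theorem parallelSum_le_add_div_four (hu : 0 ≤ u) (hv : 0 ≤ v) :
    parallelSum u v ≤ (u + v) / 4 :=
  div_le_of_le_mul₀ (add_nonneg hu hv) (by positivity) (by nlinarith [sq_nonneg (u - v)])

theorem parallelSum_mul_add_le {d e : ℝ} (hu : 0 ≤ u) (hv : 0 ≤ v) (hd : 0 ≤ d) (he : 0 ≤ e) :
    parallelSum u v * (d + e) ≤ u * d + v * e := by
  have hle_right : parallelSum u v ≤ v := parallelSum_comm u v ▸ parallelSum_le_left hv hu
  rw [mul_add]
  gcongr
  exact parallelSum_le_left hu hv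

/-- With `A = u * p + v * q` and `B = u * q + v * p` the right-hand side is
`u v p q (1 / A + 1 / B)`, and `1 / A + 1 / B ≥ 4 / (A + B)` with `A + B = u + v`. -/
theorem four_mul_parallelSum_le {p q : ℝ} (hu : 0 ≤ u) (hv : 0 ≤ v) (hp : 0 ≤ p) (hq : 0 ≤ q)
    (hpq : p + q = 1) :
    4 * p * q * parallelSum u v ≤
      parallelSum (u * p) (v * q) + parallelSum (u * q) (v * p) := by
  have hnonneg := add_nonneg (parallelSum_nonneg (mul_nonneg hu hp) (mul_nonneg hv hq))
    (parallelSum_nonneg (mul_nonneg hu hq) (mul_nonneg hv hp))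
  rcases hu.eq_or_lt with rfl | hu
  · simp [parallelSum]
  rcases hv.eq_or_lt with rfl | hv
  · simp [parallelSum]
  rcases hp.eq_or_lt with rfl | hp
  · simpa only [mul_zero, zero_mul] using hnonneg
  rcases hq.eq_or_lt with rfl | hq
  · simpa only [mul_zero, zero_mul] using hnonneg
  have hA : 0 < u * p + v * q := by positivity
  have hB : 0 < u * q + v * p := by positivity
  have hAB : (u * p + v * q) + (u * q + v * p) = u + v := by linear_combination (u + v) * hpq
  have hsum : parallelSum (u * p) (v * q) + parallelSum (u * q) (v * p) =
      u * v * p * q * ((u + v) / ((u * p + v * q) * (u * q + v * p))) := by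
    rw [← hAB, parallelSum, parallelSum]
    field_simp [hA.ne', hB.ne']
    ring
  have hamgm : 4 / (u + v) ≤ (u + v) / ((u * p + v * q) * (u * q + v * p)) := by
    rw [div_le_div_iff₀ (by positivity) (mul_pos hA hB), ← hAB]
    nlinarith [sq_nonneg ((u * p + v * q) - (u * q + v * p))]
  calc 4 * p * q * parallelSum u v = u * v * p * q * (4 / (u + v)) := by
        rw [parallelSum]; ring
    _ ≤ _ := by rw [hsum]; gcongr

end ParallelSum

section AverageTotal

variable {m n T : ℕ} [NeZero m] {β : Type*} [Fintype β]

/-- The total of `D σ_t x_t`, averaged over the outcomes `ρ x_1, …, ρ x_T` with independent `x_t` of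
law `P`. -/
noncomputable def averageTotal (ρ : β → Relevance m n) (P : β → ℝ)
    (D : Equiv.Perm (Fin m) → β → ℝ) (a : Strategy m n T) : ℝ :=
  ∑ x : Fin T → β, (∏ s, P (x s)) * ∑ t, D (played a (ρ ∘ x) t) (x t)

theorem sum_prod_eq_one {P : β → ℝ} (hP : ∑ b, P b = 1) (T : ℕ) :
    ∑ x : Fin T → β, ∏ s, P (x s) = 1 := by
  rw [← Fintype.sum_pow, hP, one_pow]

theorem averageTotal_succ (ρ : β → Relevance m n) {P : β → ℝ} (hP : ∑ b, P b = 1)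
    (D : Equiv.Perm (Fin m) → β → ℝ) (a : Strategy m n (T + 1)) :
    averageTotal ρ P D a = ∑ b, P b * D (a 0 Fin.elim0) b +
      ∑ b, P b * averageTotal ρ P D (tailStrategy a (ρ b (topObject (a 0 Fin.elim0)))) := by
  unfold averageTotal
  rw [← (Fin.consEquiv fun _ : Fin (T + 1) => β).sum_comp, Fintype.sum_prod_type,
    ← Finset.sum_add_distrib]
  refine Finset.sum_congr rfl fun b _ => ?_
  rw [← mul_add, ← mul_one (D _ b), ← sum_prod_eq_one hP T, Finset.mul_sum,
    ← Finset.sum_add_distrib, Finset.mul_sum]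
  refine Finset.sum_congr rfl fun x _ => ?_
  have hcons : ρ ∘ (Fin.cons b x : Fin (T + 1) → β) = Fin.cons (ρ b) (ρ ∘ x) := by
    funext s
    refine Fin.cases ?_ (fun s => ?_) s <;> simp
  simp only [Fin.consEquiv, Equiv.coe_fn_mk]
  rw [hcons, Fin.prod_univ_succ, Fin.sum_univ_succ, played_zero]
  simp only [played_succ, Fin.cons_zero, Fin.cons_succ]
  ring

variable (L : Learner m n T) (gain : Equiv.Perm (Fin m) → Relevance m n → ℝ)
  (ρ : β → Relevance m n) (P : β → ℝ) (σ : Equiv.Perm (Fin m))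

theorem integrable_mul_sum_sub_played {β : Type*} (ρ : β → Relevance m n) (P : β → ℝ)
    (x : Fin T → β) :
    @Integrable _ _ _ _ L.mΩ (fun ω => (∏ s, P (x s)) *
      ∑ t, (gain σ (ρ (x t)) - gain (played (L.act ω) (ρ ∘ x) t) (ρ (x t)))) L.μ := by
  let _ := L.mΩ
  have := L.prob
  exact (integrable_finsetSum _ fun t _ => (integrable_const _).sub
    (integrable_played L _ t fun σ => gain σ (ρ (x t)))).const_mul _

theorem integrable_averageTotal :
    @Integrable _ _ _ _ L.mΩ
      (fun ω => averageTotal ρ P (fun τ b => gain σ (ρ b) - gain τ (ρ b)) (L.act ω)) L.μ :=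
  let _ := L.mΩ
  integrable_finsetSum _ fun x _ => integrable_mul_sum_sub_played L gain σ ρ P x

theorem integral_averageTotal_le {P} (hP0 : ∀ b, 0 ≤ P b) (hP : ∑ b, P b = 1) {M : ℝ}
    (hM : ∀ x : Fin T → β, regret L gain (ρ ∘ x) ≤ M) :
    ∫ ω, averageTotal ρ P (fun τ b => gain σ (ρ b) - gain τ (ρ b)) (L.act ω) ∂L.μ ≤ M := by
  let _ := L.mΩ
  calc ∫ ω, averageTotal ρ P (fun τ b => gain σ (ρ b) - gain τ (ρ b)) (L.act ω) ∂L.μ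
      = ∑ x : Fin T → β, (∏ s, P (x s)) *
          ∫ ω, ∑ t, (gain σ (ρ (x t)) - gain (played (L.act ω) (ρ ∘ x) t) (ρ (x t))) ∂L.μ := by
        simp only [averageTotal]
        rw [integral_finsetSum _ fun x _ => integrable_mul_sum_sub_played L gain σ ρ P x]
        simp only [integral_const_mul]
    _ ≤ ∑ x : Fin T → β, (∏ s, P (x s)) * M := by
        gcongr with x
        · exact Finset.prod_nonneg fun s _ => hP0 _
        · exact (integral_sum_sub_played_le_regret L gain (ρ ∘ x) σ).trans (hM x)
    _ = M := by rw [← Finset.sum_mul, sum_prod_eq_one hP, one_mul]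

theorem exists_le_regret_of_le_averageTotal [Nonempty β] {P Q : β → ℝ} (hP0 : ∀ b, 0 ≤ P b)
    (hP : ∑ b, P b = 1) (hQ0 : ∀ b, 0 ≤ Q b) (hQ : ∑ b, Q b = 1) (σ τ : Equiv.Perm (Fin m))
    {c : ℝ} (hc : ∀ a : Strategy m n T, 2 * c ≤
      averageTotal ρ P (fun κ b => gain σ (ρ b) - gain κ (ρ b)) a +
        averageTotal ρ Q (fun κ b => gain τ (ρ b) - gain κ (ρ b)) a) :
    ∃ r : Fin T → Relevance m n, c ≤ regret L gain r := by
  let _ := L.mΩ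
  have := L.prob
  obtain ⟨x, hx⟩ := Finite.exists_max fun x : Fin T → β => regret L gain (ρ ∘ x)
  have hint := integrable_averageTotal L gain ρ P σ
  have hint' := integrable_averageTotal L gain ρ Q τ
  have hmono := integral_mono (integrable_const (2 * c)) (hint.add hint') fun ω => hc (L.act ω)
  simp only [Pi.add_apply] at hmono
  rw [integral_const, probReal_univ, one_smul, integral_add hint hint'] at hmono
  have hle := integral_averageTotal_le L gain ρ σ hP0 hP hx
  have hle' := integral_averageTotal_le L gain ρ τ hQ0 hQ hx
  exact ⟨ρ ∘ x, by linarith⟩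

end AverageTotal

section TwoPoint

variable {m n T : ℕ} [NeZero m]

/-- The law of a coin that shows `true` with probability `p`. -/
def coin (p : ℝ) (b : Bool) : ℝ := if b then p else 1 - p

theorem sum_coin_mul (p : ℝ) (f : Bool → ℝ) :
    ∑ b, coin p b * f b = p * f true + (1 - p) * f false := by
  simp [coin]

theorem sum_coin (p : ℝ) : ∑ b, coin p b = 1 := by
  simp [coin]

theorem coin_nonneg {p : ℝ} (hp : p ∈ Set.Icc (0 : ℝ) 1) (b : Bool) : 0 ≤ coin p b := by
  cases b
  · simpa [coin] using hp.2
  · simpa [coin] using hp.1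

/-- One round in which the coin is observed: paying the loss `κ` covers both the gain of the round
and the decrease of the potential over the remaining `T` rounds. -/
theorem add_one_mul_parallelSum_le {u v p Θ κ d e : ℝ} {T N : ℕ} (hu : 0 ≤ u) (hv : 0 ≤ v)
    (hp : p ∈ Set.Icc (0 : ℝ) 1) (hΘ : 0 ≤ Θ) (hd : κ ≤ d) (he : κ ≤ e) (hTN : T ≤ N)
    (hκ : Θ * (1 + N * (2 * p - 1) ^ 2) ≤ 4 * κ) :
    (T + 1) * Θ * parallelSum u v ≤ u * d + v * e +
      T * Θ * (parallelSum (u * p) (v * (1 - p)) + parallelSum (u * (1 - p)) (v * p)) := by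
  have hpay : u * κ + v * κ ≤ u * d + v * e := by gcongr
  have hdecrease : Θ * (1 + T * (2 * p - 1) ^ 2) * parallelSum u v ≤ 4 * κ * ((u + v) / 4) :=
    calc Θ * (1 + T * (2 * p - 1) ^ 2) * parallelSum u v
        ≤ Θ * (1 + N * (2 * p - 1) ^ 2) * ((u + v) / 4) := by
          gcongr
          · exact parallelSum_nonneg hu hv
          · exact parallelSum_le_add_div_four hu hv
      _ ≤ _ := by gcongr
  have hpotential := mul_le_mul_of_nonneg_left
    (four_mul_parallelSum_le hu hv hp.1 (sub_nonneg.2 hp.2) (add_sub_cancel p 1))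
    (mul_nonneg T.cast_nonneg hΘ)
  linear_combination hpay + hdecrease + hpotential

/-- The potential of the current weights of the two hypotheses drops only in the rounds that reveal
the coin, and each of these costs at least `κ` under both hypotheses. -/
theorem mul_parallelSum_le_averageTotal (ρ : Bool → Relevance m n)
    {D E : Equiv.Perm (Fin m) → Bool → ℝ} {p Θ κ : ℝ} {N : ℕ} (hp : p ∈ Set.Icc (0 : ℝ) 1)
    (hΘ : 0 ≤ Θ) (hD : ∀ σ, 0 ≤ ∑ b, coin p b * D σ b) (hE : ∀ σ, 0 ≤ ∑ b, coin (1 - p) b * E σ b)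
    (hDE : ∀ σ, Θ ≤ ∑ b, coin p b * D σ b + ∑ b, coin (1 - p) b * E σ b)
    (hreveal : ∀ σ, ρ true (topObject σ) ≠ ρ false (topObject σ) →
      κ ≤ ∑ b, coin p b * D σ b ∧ κ ≤ ∑ b, coin (1 - p) b * E σ b)
    (hκ : Θ * (1 + N * (2 * p - 1) ^ 2) ≤ 4 * κ) (hT : T ≤ N) (a : Strategy m n T) {u v : ℝ}
    (hu : 0 ≤ u) (hv : 0 ≤ v) :
    T * Θ * parallelSum u v ≤
      u * averageTotal ρ (coin p) D a + v * averageTotal ρ (coin (1 - p)) E a := by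
  induction T generalizing u v with
  | zero => simp [averageTotal]
  | succ T ih =>
  set σ := a 0 Fin.elim0
  rw [averageTotal_succ ρ (sum_coin p), averageTotal_succ ρ (sum_coin (1 - p)),
    sum_coin_mul p fun b => averageTotal _ _ _ _,
    sum_coin_mul (1 - p) fun b => averageTotal _ _ _ _,
    sub_sub_cancel, Nat.cast_succ]
  by_cases hσ : ρ true (topObject σ) = ρ false (topObject σ)
  · have hloss : parallelSum u v * Θ ≤ _ :=
      (mul_le_mul_of_nonneg_left (hDE σ) (parallelSum_nonneg hu hv)).trans
        (parallelSum_mul_add_le hu hv (hD σ) (hE σ))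
    rw [hσ]
    linear_combination hloss +
      ih (Nat.le_of_succ_le hT) (tailStrategy a (ρ false (topObject σ))) hu hv
  · obtain ⟨hDσ, hEσ⟩ := hreveal σ hσ
    have hq := sub_nonneg.2 hp.2
    linear_combination
      add_one_mul_parallelSum_le hu hv hp hΘ hDσ hEσ (Nat.le_of_succ_le hT) hκ +
      ih (Nat.le_of_succ_le hT) (tailStrategy a (ρ true (topObject σ)))
        (mul_nonneg hu hp.1) (mul_nonneg hv hq) +
      ih (Nat.le_of_succ_le hT) (tailStrategy a (ρ false (topObject σ)))
        (mul_nonneg hu hq) (mul_nonneg hv hp.1)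

end TwoPoint

section LowerBound

variable {k n : ℕ}

/-- Object `0` is relevant, and so is one of the objects `1` and `2`, according to a coin. -/
def coinOutcome (k n : ℕ) (b : Bool) : Relevance (k + 3) n := fun i =>
  if (i : ℕ) = 0 ∨ (i : ℕ) = (if b then 1 else 2) then 1 else 0

/-- The mean gains of the objects under `coinOutcome` for a coin of bias `p`. -/
def coinMean (k : ℕ) (p : ℝ) : Fin (k + 3) → ℝ := fun i =>
  match (i : ℕ) with
  | 0 => 1
  | 1 => p
  | 2 => 1 - p
  | _ => 0

theorem coinMean_zero (p : ℝ) : coinMean k p 0 = 1 := rfl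

theorem coinMean_one (p : ℝ) : coinMean k p 1 = p := rfl

theorem coinMean_two (p : ℝ) : coinMean k p 2 = 1 - p := by
  simp only [coinMean, Fin.val_two]

theorem sum_coin_mul_relevanceGain (hn : 1 ≤ n) (p : ℝ) :
    p • relevanceGain (coinOutcome k n true) + (1 - p) • relevanceGain (coinOutcome k n false) =
      coinMean k p := by
  obtain ⟨n, rfl⟩ := Nat.exists_eq_add_of_le' hn
  funext ⟨i, hi⟩
  rcases i with _ | _ | _ | i <;> simp [relevanceGain, coinOutcome, coinMean] <;> norm_num

theorem antitone_coinMean {p : ℝ} (hp : p ∈ Set.Icc (1 / 2 : ℝ) 1) : Antitone (coinMean k p) := by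
  obtain ⟨hp, hp'⟩ := hp
  rintro ⟨i, hi⟩ ⟨j, hj⟩ hij
  replace hij : i ≤ j := hij
  rcases i with _ | _ | _ | i <;> rcases j with _ | _ | _ | j <;>
    simp only [coinMean] <;> first | omega | linarith

theorem coinMean_comp_swap (p : ℝ) : coinMean k p ∘ Equiv.swap 1 2 = coinMean k (1 - p) := by
  funext i
  rcases eq_or_ne i 1 with rfl | h1
  · simp [coinMean_one, coinMean_two]
  rcases eq_or_ne i 2 with rfl | h2
  · simp [coinMean_one, coinMean_two]
  rw [Function.comp_apply, Equiv.swap_apply_of_ne_of_ne h1 h2]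
  obtain ⟨i, hi⟩ := i
  rcases i with _ | _ | _ | i
  · rfl
  · exact absurd rfl h1
  · exact absurd (Fin.ext Fin.val_two.symm) h2
  · rfl

/-- The expected loss of `σ`, relative to the identity, in a round of outcome `coinOutcome` with a
coin of bias `p`. -/
noncomputable def coinLoss (p : ℝ) (σ : Equiv.Perm (Fin (k + 3))) : ℝ :=
  discountVector 1 ⬝ᵥ coinMean k p - discountVector σ ⬝ᵥ coinMean k p

theorem discountVector_mul_swap_dotProduct_coinMean (p : ℝ) (σ : Equiv.Perm (Fin (k + 3))) :
    discountVector (σ * Equiv.swap 1 2) ⬝ᵥ coinMean k p =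
      discountVector σ ⬝ᵥ coinMean k (1 - p) := by
  rw [← coinMean_comp_swap, ← comp_equiv_symm_dotProduct]
  rfl

theorem sum_coin_mul_dcg_one_sub (hn : 1 ≤ n) (p : ℝ) (σ : Equiv.Perm (Fin (k + 3))) :
    ∑ b, coin p b * (dcg 1 (coinOutcome k n b) - dcg σ (coinOutcome k n b)) = coinLoss p σ := by
  simp only [dcg_eq_dotProduct, ← sub_dotProduct]
  rw [sum_coin_mul, coinLoss, ← sub_dotProduct, ← sum_coin_mul_relevanceGain hn, dotProduct_add,
    dotProduct_smul, dotProduct_smul, smul_eq_mul, smul_eq_mul]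

theorem sum_coin_mul_dcg_swap_sub (hn : 1 ≤ n) (p : ℝ) (σ : Equiv.Perm (Fin (k + 3))) :
    ∑ b, coin (1 - p) b * (dcg (Equiv.swap 1 2) (coinOutcome k n b) - dcg σ (coinOutcome k n b)) =
      coinLoss p (σ * Equiv.swap 1 2) := by
  have hopt := discountVector_mul_swap_dotProduct_coinMean p (Equiv.swap (1 : Fin (k + 3)) 2)
  rw [Equiv.swap_mul_self] at hopt
  simp only [dcg_eq_dotProduct, ← sub_dotProduct]
  rw [sum_coin_mul, coinLoss, discountVector_mul_swap_dotProduct_coinMean, hopt, ← sub_dotProduct,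
    ← sum_coin_mul_relevanceGain hn, dotProduct_add, dotProduct_smul, dotProduct_smul, smul_eq_mul,
    smul_eq_mul]

theorem coinLoss_nonneg {p : ℝ} (hp : p ∈ Set.Icc (1 / 2 : ℝ) 1) (σ : Equiv.Perm (Fin (k + 3))) :
    0 ≤ coinLoss p σ :=
  sub_nonneg.2 <| comp_perm_dotProduct_le (σ := 1) strictAnti_discount_val.antitone
    (fun _ _ h => antitone_coinMean hp h.le) σ

/-- The sum of the mean gains for the biases `p` and `1 - p` is twice that for a fair coin, so the
best ranking for the sum, which is that for `p`, loses against the best one for `1 - p`. -/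
theorem mul_le_coinLoss_add_coinLoss (p : ℝ) (σ : Equiv.Perm (Fin (k + 3))) :
    (2 * p - 1) * (discount 1 - discount 2) ≤
      coinLoss p σ + coinLoss p (σ * Equiv.swap 1 2) := by
  have hfair : coinMean k p + coinMean k (1 - p) = (2 : ℝ) • coinMean k (1 / 2) := by
    funext ⟨i, hi⟩
    rcases i with _ | _ | _ | i <;> simp [coinMean] <;> norm_num
  have hsum := congrArg (discountVector σ ⬝ᵥ ·) hfair
  have hsum' := congrArg (discountVector 1 ⬝ᵥ ·) hfair
  have hopt := coinLoss_nonneg (p := 1 / 2) (by norm_num) σ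
  have hswap := discountVector_mul_swap_dotProduct (1 : Equiv.Perm (Fin (k + 3))) 1 2 (coinMean k p)
  rw [discountVector_mul_swap_dotProduct_coinMean] at hswap
  simp only [dotProduct_add, dotProduct_smul, smul_eq_mul] at hsum hsum'
  simp only [coinLoss, discountVector_mul_swap_dotProduct_coinMean] at hopt ⊢
  simp only [Equiv.Perm.one_apply, coinMean_one, coinMean_two, Fin.val_one, Fin.val_two] at hswap
  linarith

/-- `1 / 12 = (1 - 2 / 3) * (1 / 4)` is the least gain from exchanging the object on top with the
object `0`. -/
theorem le_coinLoss_of_topObject {p : ℝ} (hp : p ∈ Set.Icc (1 / 2 : ℝ) 1) (hp' : p ≤ 3 / 4)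
    {σ : Equiv.Perm (Fin (k + 3))} (hσ : topObject σ = 1 ∨ topObject σ = 2) :
    1 / 12 ≤ coinLoss p σ := by
  set o := topObject σ
  have htop : σ o = 0 := topObject_eq_iff.1 rfl
  have hgap : 1 / 4 ≤ 1 - coinMean k p o := by
    rcases hσ with h | h
    · rw [h, coinMean_one]
      linarith
    · rw [h, coinMean_two]
      linarith [hp.1]
  have ho : o ≠ 0 := by
    intro h
    rw [h, coinMean_zero] at hgap
    norm_num at hgap
  have hrank : 1 ≤ (σ 0 : ℕ) :=
    Nat.one_le_iff_ne_zero.2 fun h => ho (σ.injective (htop.trans (Fin.ext h).symm))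
  have hdiscount := (discount_strictAnti.antitone hrank).trans discount_one_mem_Icc.2
  have hswap := discountVector_mul_swap_dotProduct σ 0 o (coinMean k p)
  rw [htop, Fin.val_zero, discount_zero, coinMean_zero] at hswap
  have hnonneg := coinLoss_nonneg hp (σ * Equiv.swap 0 o)
  rw [coinLoss] at hnonneg ⊢
  nlinarith

theorem topObject_eq_of_coinOutcome_ne {σ : Equiv.Perm (Fin (k + 3))}
    (h : coinOutcome k n true (topObject σ) ≠ coinOutcome k n false (topObject σ)) :
    topObject σ = 1 ∨ topObject σ = 2 := by
  contrapose! h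
  simp only [ne_eq, Fin.ext_iff, Fin.val_one, Fin.val_two] at h
  simp [coinOutcome, h]

theorem topObject_mul_swap {m : ℕ} [NeZero m] (σ : Equiv.Perm (Fin m)) (a b : Fin m) :
    topObject (σ * Equiv.swap a b) = Equiv.swap a b (topObject σ) := by
  simp [topObject, Equiv.Perm.mul_def]

end LowerBound

/-- The bias `T ^ (-1/3)` makes the loss `T δ` of confusing the coins and the price `1 / δ ^ 2` of
telling them apart equal. -/
theorem exists_bias (T : ℕ) :
    ∃ δ : ℝ, 0 ≤ δ ∧ δ ≤ 1 / 4 ∧ T * δ ^ 3 ≤ 1 / 64 ∧ T * δ = (T : ℝ) ^ (2 / 3 : ℝ) / 4 := by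
  rcases T.eq_zero_or_pos with rfl | hT
  · exact ⟨0, by norm_num⟩
  have hT' : (0 : ℝ) < T := mod_cast hT
  have hcube : ((T : ℝ) ^ (-(1 / 3) : ℝ)) ^ 3 = (T : ℝ)⁻¹ := by
    rw [← Real.rpow_natCast, ← Real.rpow_mul hT'.le, ← Real.rpow_neg_one]
    norm_num
  have hmul : (T : ℝ) * (T : ℝ) ^ (-(1 / 3) : ℝ) = (T : ℝ) ^ (2 / 3 : ℝ) := by
    rw [mul_comm, ← Real.rpow_add_one hT'.ne']
    norm_num
  have hle : (T : ℝ) ^ (-(1 / 3) : ℝ) ≤ 1 :=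
    Real.rpow_le_one_of_one_le_of_nonpos (mod_cast hT) (by norm_num)
  refine ⟨(T : ℝ) ^ (-(1 / 3) : ℝ) / 4, by positivity, by linarith, ?_, by rw [← hmul]; ring⟩
  rw [div_pow, hcube]
  field_simp
  norm_num

theorem exists_regret_dcg_ge {m n T : ℕ} [NeZero m] (hm : 3 ≤ m) (hn : 1 ≤ n)
    (L : Learner m n T) :
    ∃ r : Fin T → Relevance m n, 1 / 64 * (T : ℝ) ^ (2 / 3 : ℝ) ≤ regret L dcg r := by
  obtain ⟨k, rfl⟩ := Nat.exists_eq_add_of_le' hm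
  obtain ⟨δ, hδ0, hδ, hcube, hmul⟩ := exists_bias T
  have hp : 1 / 2 + δ ∈ Set.Icc (1 / 2 : ℝ) 1 := ⟨by linarith, by linarith⟩
  have hp01 : 1 / 2 + δ ∈ Set.Icc (0 : ℝ) 1 := ⟨by linarith, hp.2⟩
  have hq01 : 1 - (1 / 2 + δ) ∈ Set.Icc (0 : ℝ) 1 := ⟨by linarith, by linarith⟩
  obtain ⟨hd1, hd1'⟩ := discount_one_mem_Icc
  have hd2 := discount_two
  refine exists_le_regret_of_le_averageTotal L dcg (coinOutcome k n) (coin_nonneg hp01)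
    (sum_coin _) (coin_nonneg hq01) (sum_coin _) 1 (Equiv.swap 1 2) fun a => ?_
  have htotal := mul_parallelSum_le_averageTotal (coinOutcome k n)
    (D := fun σ b => dcg 1 (coinOutcome k n b) - dcg σ (coinOutcome k n b))
    (E := fun σ b => dcg (Equiv.swap 1 2) (coinOutcome k n b) - dcg σ (coinOutcome k n b))
    (Θ := 2 * δ * (discount 1 - discount 2)) (κ := 1 / 12) (N := T) (u := 1) (v := 1) hp01
    (mul_nonneg (by linarith) (by linarith))
    (fun σ => ?_) (fun σ => ?_) (fun σ => ?_) (fun σ hσ => ?_) ?_ le_rfl a zero_le_one zero_le_one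
  · rw [parallelSum] at htotal
    nlinarith [mul_le_mul_of_nonneg_left (show (1 / 8 : ℝ) ≤ discount 1 - discount 2 by linarith)
      (show 0 ≤ T * δ by positivity)]
  · exact (coinLoss_nonneg hp σ).trans_eq (sum_coin_mul_dcg_one_sub hn _ σ).symm
  · exact (coinLoss_nonneg hp _).trans_eq (sum_coin_mul_dcg_swap_sub hn _ σ).symm
  · rw [sum_coin_mul_dcg_one_sub hn, sum_coin_mul_dcg_swap_sub hn]
    convert mul_le_coinLoss_add_coinLoss (1 / 2 + δ) σ using 2
    ring
  · have htop := topObject_eq_of_coinOutcome_ne hσ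
    rw [sum_coin_mul_dcg_one_sub hn, sum_coin_mul_dcg_swap_sub hn]
    refine ⟨le_coinLoss_of_topObject hp (by linarith) htop,
      le_coinLoss_of_topObject hp (by linarith) ?_⟩
    rw [topObject_mul_swap]
    rcases htop with h | h <;> simp [h]
  · have hgap : discount 1 - discount 2 ≤ 1 / 6 := by linarith
    nlinarith [mul_le_mul_of_nonneg_right hgap (show 0 ≤ δ + 4 * (T * δ ^ 3) by positivity)]

/-! ### Follow the perturbed leader -/

section UniformCube

/-- Truncating `h` to `I` before the translation leaves a nonnegative function, whose integral over
`I` only grows when it is extended to the whole group. -/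
theorem integral_cond_comp_add_right_le {E : Type*} [AddGroup E] [MeasurableSpace E]
    [MeasurableAdd E] {μ : Measure E} [μ.IsAddRightInvariant] {I : Set E} (hI : MeasurableSet I)
    (hI' : μ I ≠ ⊤) {h : E → ℝ} (hm : Measurable h) {R : ℝ} (hR : ∀ q, h q ∈ Set.Icc 0 R) (v : E) :
    ∫ q, h (q + v) ∂cond μ I ≤ ∫ q, h q ∂cond μ I + R * (cond μ I).real {q | q + v ∉ I} := by
  have habs (q : E) : ‖h q‖ ≤ R := by
    rw [Real.norm_eq_abs, abs_of_nonneg (hR q).1]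
    exact (hR q).2
  have hnonneg : 0 ≤ I.indicator h := fun q => Set.indicator_nonneg (fun q _ => (hR q).1) q
  have hint : Integrable (I.indicator h) μ := (integrable_indicator_iff hI).2 <|
    Measure.integrableOn_of_bounded hI' hm.aestronglyMeasurable (.of_forall habs)
  have hinside : Integrable (fun q => I.indicator h (q + v)) (cond μ I) :=
    Integrable.of_bound ((hm.indicator hI).comp (measurable_add_const v)).aestronglyMeasurable R
      (.of_forall fun q => (norm_indicator_le_norm_self h _).trans (habs _))
  have hescape : MeasurableSet {q | q + v ∉ I} := (hI.preimage (measurable_add_const v)).compl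
  have houtside : Integrable ({q | q + v ∉ I}.indicator fun _ => R) (cond μ I) :=
    (integrable_const R).indicator hescape
  have htranslate : ∫ q, I.indicator h (q + v) ∂cond μ I ≤ ∫ q, h q ∂cond μ I := by
    rw [ProbabilityTheory.cond, integral_smul_measure, integral_smul_measure,
      ← integral_indicator hI (f := h), ← integral_add_right_eq_self (I.indicator h) v]
    exact smul_le_smul_of_nonneg_left (setIntegral_le_integral (hint.comp_add_right v)
      (.of_forall fun q => hnonneg (q + v))) ENNReal.toReal_nonneg
  calc ∫ q, h (q + v) ∂cond μ I
      ≤ ∫ q, I.indicator h (q + v) + {q | q + v ∉ I}.indicator (fun _ => R) q ∂cond μ I := by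
        refine integral_mono (Integrable.of_bound
          (hm.comp (measurable_add_const v)).aestronglyMeasurable R (.of_forall fun q => habs _))
          (hinside.add houtside) fun q => ?_
        by_cases hq : q + v ∈ I
        · simp [hq]
        · simpa [hq] using (hR (q + v)).2
    _ ≤ ∫ q, h q ∂cond μ I + R * (cond μ I).real {q | q + v ∉ I} := by
        rw [integral_add hinside houtside, integral_indicator_const _ hescape, smul_eq_mul,
          mul_comm R]
        gcongr

theorem pi_cond {ι : Type*} [Fintype ι] {α : ι → Type*} [∀ i, MeasurableSpace (α i)]
    (μ : ∀ i, Measure (α i)) [∀ i, SigmaFinite (μ i)] {s : ∀ i, Set (α i)}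
    (hs : ∀ i, MeasurableSet (s i)) (hs0 : ∀ i, μ i (s i) ≠ 0) :
    Measure.pi (fun i => cond (μ i) (s i)) = cond (Measure.pi μ) (Set.univ.pi s) := by
  refine Measure.pi_eq fun t _ => ?_
  rw [cond_apply (MeasurableSet.univ_pi hs), ← Set.pi_inter_distrib, Measure.pi_pi, Measure.pi_pi,
    ENNReal.prod_inv_distrib fun i _ _ _ _ => Or.inl (hs0 i), ← Finset.prod_mul_distrib]
  exact Finset.prod_congr rfl fun i _ => (cond_apply (hs i) _ _).symm

variable (ι : Type*) [Fintype ι] {L : ℝ}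

/-- The uniform distribution on the cube `[0, L] ^ ι`. -/
noncomputable def uniformCube (L : ℝ) : Measure (ι → ℝ) :=
  Measure.pi fun _ => cond volume (Set.Icc 0 L)

theorem isProbabilityMeasure_cond_Icc (hL : 0 < L) :
    IsProbabilityMeasure (cond (volume : Measure ℝ) (Set.Icc 0 L)) :=
  cond_isProbabilityMeasure_of_finite (by simpa [Real.volume_Icc] using hL)
    (by simp [Real.volume_Icc])

theorem isProbabilityMeasure_uniformCube (hL : 0 < L) : IsProbabilityMeasure (uniformCube ι L) :=
  have := isProbabilityMeasure_cond_Icc hL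
  Measure.pi.instIsProbabilityMeasure _

theorem uniformCube_eq_cond (hL : 0 < L) :
    uniformCube ι L = ProbabilityTheory.cond volume (Set.Icc 0 fun _ => L) := by
  rw [uniformCube, pi_cond _ (fun _ => measurableSet_Icc) fun _ => by simpa using hL,
    Set.pi_univ_Icc, volume_pi]
  rfl

variable {ι}

theorem ae_mem_Icc_uniformCube (hL : 0 < L) :
    ∀ᵐ q ∂uniformCube ι L, q ∈ Set.Icc 0 fun _ => L := by
  rw [uniformCube_eq_cond ι hL]
  exact ae_cond_mem measurableSet_Icc

theorem cond_Icc_real_add_notMem_le (hL : 0 < L) {v : ℝ} (hv : 0 ≤ v) :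
    (ProbabilityTheory.cond volume (Set.Icc 0 L)).real {x | x + v ∉ Set.Icc 0 L} ≤ v / L := by
  have hsubset : Set.Icc 0 L ∩ {x | x + v ∉ Set.Icc 0 L} ⊆ Set.Ioc (L - v) L := by
    rintro x ⟨⟨hx, hxL⟩, hxv⟩
    refine ⟨lt_of_not_ge fun hle => hxv ⟨by linarith, by linarith⟩, hxL⟩
  have hlength := measureReal_mono (μ := volume) hsubset (by simp)
  rw [Real.volume_real_Ioc_of_le (by linarith), sub_sub_cancel] at hlength
  rw [Measure.real, cond_apply measurableSet_Icc, ENNReal.toReal_mul,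
    ENNReal.toReal_inv, ← measureReal_def, ← measureReal_def, Real.volume_real_Icc_of_le hL.le,
    sub_zero, inv_mul_eq_div]
  gcongr

theorem uniformCube_real_add_notMem_le (hL : 0 < L) {v : ι → ℝ} (hv : 0 ≤ v) :
    (uniformCube ι L).real {q | q + v ∉ Set.Icc 0 fun _ => L} ≤ (∑ i, v i) / L := by
  have := isProbabilityMeasure_cond_Icc hL
  have := isProbabilityMeasure_uniformCube ι hL
  have hunion : {q : ι → ℝ | q + v ∉ Set.Icc 0 fun _ => L} =
      ⋃ i ∈ Finset.univ, {q | q i + v i ∉ Set.Icc 0 L} := by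
    ext q
    simp [← Set.pi_univ_Icc]
  rw [hunion, Finset.sum_div]
  refine (measureReal_biUnion_finset_le _ _).trans (Finset.sum_le_sum fun i _ => ?_)
  have hmarginal := (measurePreserving_eval (fun _ : ι => cond volume (Set.Icc 0 L)) i)
    |>.measureReal_preimage (s := {x | x + v i ∉ Set.Icc 0 L})
      (measurableSet_Icc.preimage (measurable_add_const _)).compl.nullMeasurableSet
  exact hmarginal.trans_le (cond_Icc_real_add_notMem_le hL (hv i))

theorem integral_uniformCube_comp_add_le (hL : 0 < L) {h : (ι → ℝ) → ℝ} (hm : Measurable h)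
    {R : ℝ} (hR : ∀ q, h q ∈ Set.Icc 0 R) {v : ι → ℝ} (hv : 0 ≤ v) :
    ∫ q, h (q + v) ∂uniformCube ι L ≤ ∫ q, h q ∂uniformCube ι L + R * ((∑ i, v i) / L) := by
  have hR0 : 0 ≤ R := (hR 0).1.trans (hR 0).2
  have hescape := uniformCube_real_add_notMem_le hL hv
  rw [uniformCube_eq_cond ι hL] at hescape ⊢
  refine (integral_cond_comp_add_right_le measurableSet_Icc ?_ hm hR v).trans (by gcongr)
  exact isCompact_Icc.measure_ne_top

end UniformCube

section LinearMaximizer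

variable {ι : Type*} [Fintype ι] {D : Set (ι → ℝ)} {w : (ι → ℝ) → ι → ℝ}

/-- `w` selects from `D` a maximizer of the linear functional given by its argument. -/
structure IsLinearMaximizer (D : Set (ι → ℝ)) (w : (ι → ℝ) → ι → ℝ) : Prop where
  mem : ∀ y, w y ∈ D
  dotProduct_le : ∀ x ∈ D, ∀ y, x ⬝ᵥ y ≤ w y ⬝ᵥ y

theorem dotProduct_mem_Icc {x z : ι → ℝ} (hx : x ∈ Set.Icc 0 1) {G : ℝ}
    (hz : z ∈ Set.Icc 0 fun _ => G) : x ⬝ᵥ z ∈ Set.Icc 0 (Fintype.card ι * G) := by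
  refine ⟨Finset.sum_nonneg fun i _ => mul_nonneg (hx.1 i) (hz.1 i), ?_⟩
  calc x ⬝ᵥ z ≤ ∑ _i : ι, G := Finset.sum_le_sum fun i _ =>
        (mul_le_of_le_one_left (hz.1 i) (hx.2 i)).trans (hz.2 i)
    _ = Fintype.card ι * G := by simp

theorem IsLinearMaximizer.be_the_leader (hw : IsLinearMaximizer D w) (z : ℕ → ι → ℝ) (q : ι → ℝ)
    (K : ℕ) :
    w (∑ j ∈ Finset.range K, z j + q) ⬝ᵥ (∑ j ∈ Finset.range K, z j + q) ≤
      ∑ k ∈ Finset.range K, w (∑ j ∈ Finset.range (k + 1), z j + q) ⬝ᵥ z k + w q ⬝ᵥ q := by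
  induction K with
  | zero => simp
  | succ K ih =>
    set x := w (∑ j ∈ Finset.range (K + 1), z j + q) with hx
    have hleader := hw.dotProduct_le x (hw.mem _) (∑ j ∈ Finset.range K, z j + q)
    rw [Finset.sum_range_succ (fun k => w _ ⬝ᵥ z k), ← hx, Finset.sum_range_succ, add_right_comm,
      dotProduct_add]
    linarith

/-- The mean play of a leader that perturbs the scores `y` by a uniform vector of `[0, L] ^ ι`. -/
noncomputable def meanLeader (w : (ι → ℝ) → ι → ℝ) (L : ℝ) (y : ι → ℝ) (i : ι) : ℝ :=
  ∫ q, w (y + q) i ∂uniformCube ι L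

theorem IsLinearMaximizer.mem_Icc (hw : IsLinearMaximizer D w) (hD : D ⊆ Set.Icc 0 1)
    (y : ι → ℝ) : w y ∈ Set.Icc 0 1 := hD (hw.mem y)

variable {L : ℝ}

theorem IsLinearMaximizer.integrable_apply (hw : IsLinearMaximizer D w)
    (hD : D ⊆ Set.Icc 0 1) (hm : Measurable w) (hL : 0 < L) (y : ι → ℝ) (i : ι) :
    Integrable (fun q => w (y + q) i) (uniformCube ι L) := by
  have := isProbabilityMeasure_uniformCube ι hL
  refine Integrable.of_bound (measurable_pi_iff.1 (hm.comp (measurable_const_add y)) i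
    |>.aestronglyMeasurable) 1 (.of_forall fun q => ?_)
  have hmem := hw.mem_Icc hD (y + q)
  rw [Real.norm_eq_abs, abs_of_nonneg (hmem.1 i)]
  exact hmem.2 i

theorem IsLinearMaximizer.integrable_dotProduct (hw : IsLinearMaximizer D w)
    (hD : D ⊆ Set.Icc 0 1) (hm : Measurable w) (hL : 0 < L) (y z : ι → ℝ) :
    Integrable (fun q => w (y + q) ⬝ᵥ z) (uniformCube ι L) :=
  integrable_finsetSum _ fun i _ => (hw.integrable_apply hD hm hL y i).mul_const (z i)

theorem IsLinearMaximizer.meanLeader_dotProduct (hw : IsLinearMaximizer D w)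
    (hD : D ⊆ Set.Icc 0 1) (hm : Measurable w) (hL : 0 < L) (y z : ι → ℝ) :
    meanLeader w L y ⬝ᵥ z = ∫ q, w (y + q) ⬝ᵥ z ∂uniformCube ι L := by
  simp only [dotProduct, meanLeader, ← integral_mul_const]
  exact (integral_finsetSum _ fun i _ => (hw.integrable_apply hD hm hL y i).mul_const (z i)).symm

theorem IsLinearMaximizer.meanLeader_add_dotProduct_le (hw : IsLinearMaximizer D w)
    (hD : D ⊆ Set.Icc 0 1) (hm : Measurable w) (hL : 0 < L) {G : ℝ} (y : ι → ℝ) {v : ι → ℝ}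
    (hv : v ∈ Set.Icc 0 fun _ => G) :
    meanLeader w L (y + v) ⬝ᵥ v ≤
      meanLeader w L y ⬝ᵥ v + (Fintype.card ι * G) ^ 2 / L := by
  have hgain (q : ι → ℝ) := dotProduct_mem_Icc (hw.mem_Icc hD (y + q)) hv
  have htranslate := integral_uniformCube_comp_add_le hL (h := fun q => w (y + q) ⬝ᵥ v)
    (by unfold dotProduct; fun_prop) hgain hv.1
  have hsum : ∑ i, v i ≤ Fintype.card ι * G := by
    simpa [dotProduct] using (dotProduct_mem_Icc (x := 1) ⟨zero_le_one, le_rfl⟩ hv).2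
  rw [hw.meanLeader_dotProduct hD hm hL, hw.meanLeader_dotProduct hD hm hL]
  simp only [add_assoc, add_comm v]
  refine htranslate.trans (add_le_add_right ?_ _)
  rw [sq, mul_div_assoc]
  have hnonneg := (hgain 0).1.trans (hgain 0).2
  gcongr

theorem IsLinearMaximizer.follow_perturbed_leader (hw : IsLinearMaximizer D w)
    (hD : D ⊆ Set.Icc 0 1) (hm : Measurable w) (hL : 0 < L) {G : ℝ} {z : ℕ → ι → ℝ} {K : ℕ}
    (hz : ∀ k < K, z k ∈ Set.Icc 0 fun _ => G) {x : ι → ℝ} (hx : x ∈ D) :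
    x ⬝ᵥ ∑ k ∈ Finset.range K, z k ≤
      ∑ k ∈ Finset.range K, meanLeader w L (∑ j ∈ Finset.range k, z j) ⬝ᵥ z k +
        (Fintype.card ι * L + K * ((Fintype.card ι * G) ^ 2 / L)) := by
  have := isProbabilityMeasure_uniformCube ι hL
  have hint (k : ℕ) := hw.integrable_dotProduct hD hm hL (∑ j ∈ Finset.range (k + 1), z j) (z k)
  have hleader : ∀ᵐ q ∂uniformCube ι L, x ⬝ᵥ ∑ k ∈ Finset.range K, z k - Fintype.card ι * L ≤
      ∑ k ∈ Finset.range K, w (∑ j ∈ Finset.range (k + 1), z j + q) ⬝ᵥ z k := by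
    filter_upwards [ae_mem_Icc_uniformCube hL] with q hq
    have hbtl := hw.be_the_leader z q K
    have hmax := hw.dotProduct_le x hx (∑ k ∈ Finset.range K, z k + q)
    rw [dotProduct_add] at hmax
    linarith [(dotProduct_mem_Icc (hw.mem_Icc hD q) hq).2, (dotProduct_mem_Icc (hD hx) hq).1]
  have hbound := integral_mono_ae (integrable_const _)
    (integrable_finsetSum (Finset.range K) fun k _ => hint k) hleader
  rw [integral_const, probReal_univ, one_smul, integral_finsetSum _ fun k _ => hint k] at hbound
  have hstable : ∀ k ∈ Finset.range K,
      ∫ q, w (∑ j ∈ Finset.range (k + 1), z j + q) ⬝ᵥ z k ∂uniformCube ι L ≤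
        meanLeader w L (∑ j ∈ Finset.range k, z j) ⬝ᵥ z k + (Fintype.card ι * G) ^ 2 / L := by
    intro k hk
    rw [← hw.meanLeader_dotProduct hD hm hL, Finset.sum_range_succ]
    exact hw.meanLeader_add_dotProduct_le hD hm hL _ (hz k (Finset.mem_range.1 hk))
  have hsum := Finset.sum_le_sum hstable
  rw [Finset.sum_add_distrib, Finset.sum_const, Finset.card_range, nsmul_eq_mul] at hsum
  linarith

end LinearMaximizer

theorem ArgminRule.isLinearMaximizer {m : ℕ} (M : ArgminRule m) :
    IsLinearMaximizer (Set.range discountVector) fun y => discountVector (M.toFun y) := by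
  have hrank : StrictMono fun k : Fin m => (k : ℝ) + 1 := fun k l hkl => by simpa using hkl
  have horder (y : Fin m → ℝ) (i j : Fin m) (hij : M.toFun y i < M.toFun y j) : y j ≤ y i := by
    refine (forall_comp_perm_dotProduct_le_iff hrank.neg).1 (fun σ => ?_) i j hij
    have hneg (τ : Equiv.Perm (Fin m)) : ((-fun k : Fin m => (k : ℝ) + 1) ∘ τ) ⬝ᵥ y =
        -∑ i, (rank τ i : ℝ) * y i := by
      simp [dotProduct, rank, Pi.neg_apply, ← Finset.sum_neg_distrib, neg_mul, -neg_add_rev]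
    rw [← Pi.neg_def, hneg, hneg]
    exact neg_le_neg (M.isArgmin y σ)
  refine ⟨fun y => Set.mem_range_self _, ?_⟩
  rintro _ ⟨σ, rfl⟩ y
  exact comp_perm_dotProduct_le strictAnti_discount_val.antitone (horder y) σ

theorem ArgminRule.measurable_discountVector {m : ℕ} (M : ArgminRule m) :
    Measurable fun y => discountVector (M.toFun y) := by
  let _ : MeasurableSpace (Equiv.Perm (Fin m)) := ⊤
  exact (measurable_from_top (f := discountVector)).comp
    (measurable_to_countable' fun σ => M.measurable σ)

/-! ### Exploration -/

section Exploration

theorem measurePreserving_cond {α : Type*} [MeasurableSpace α] {μ : Measure α} {f : α → α}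
    (hf : MeasurePreserving f μ μ) {s : Set α} (hs : MeasurableSet s) (hfs : f ⁻¹' s = s) :
    MeasurePreserving f (ProbabilityTheory.cond μ s) (ProbabilityTheory.cond μ s) := by
  have hrestrict := hf.restrict_preimage hs
  rw [hfs] at hrestrict
  exact hrestrict.smul_measure _

variable (κ ι B : Type*) [Fintype κ] [MeasurableSpace B]

/-- The law of the exploration rounds: in each block of `κ`, uniformly distributed distinct
positions in `B` for the objects of `ι`, independently of the other blocks. -/
noncomputable def exploration : Measure (κ → ι → B) :=
  Measure.pi fun _ => uniformOn {f : ι → B | Function.Injective f}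

instance : IsFiniteMeasure (exploration κ ι B) := by
  unfold exploration
  infer_instance

variable [Finite ι] [Finite B] [MeasurableSingletonClass B]

instance [h : Nonempty (ι ↪ B)] : IsProbabilityMeasure (exploration κ ι B) :=
  have := isProbabilityMeasure_uniformOn (Set.toFinite {f : ι → B | Function.Injective f})
    (h.elim fun f => ⟨f, f.injective⟩)
  Measure.pi.instIsProbabilityMeasure _

theorem ae_injective_exploration : ∀ᵐ τ ∂exploration κ ι B, ∀ k, Function.Injective (τ k) :=
  ae_all_iff.2 fun _ => Measure.tendsto_eval_ae_ae.eventually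
    (ae_cond_mem (Set.toFinite {f : ι → B | Function.Injective f}).measurableSet)

variable {κ ι B}

theorem measurePreserving_add_exploration [AddGroup B] (v : κ → B) :
    MeasurePreserving (fun τ k j => τ k j + v k) (exploration κ ι B) (exploration κ ι B) := by
  refine measurePreserving_pi _ _ fun k =>
    measurePreserving_cond (f := fun f j => f j + v k)
      (measurePreserving_add_right Measure.count fun _ => v k)
      (Set.toFinite {f : ι → B | Function.Injective f}).measurableSet ?_
  ext f
  exact (add_left_injective (v k)).of_comp_iff f

/-- A cyclic shift of block `k` moves the position of `j` to every other position without changing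
`Φ` or the law of the exploration. -/
theorem integral_exploration_mul_sum {B : Type*} [MeasurableSpace B] [MeasurableSingletonClass B]
    [Fintype B] [AddGroup B] (k : κ) (j : ι) {Φ : (κ → ι → B) → ℝ} (hΦ : DependsOn Φ {k}ᶜ)
    (u : B → ℝ) :
    ∫ τ, Φ τ * ∑ b, u b ∂exploration κ ι B =
      Fintype.card B * ∫ τ, Φ τ * u (τ k j) ∂exploration κ ι B := by
  classical
  have hshift (c : B) : ∫ τ, Φ τ * u (τ k j + c) ∂exploration κ ι B =
      ∫ τ, Φ τ * u (τ k j) ∂exploration κ ι B := by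
    let v : κ → B := Pi.single k c
    have hpreserving := measurePreserving_add_exploration (ι := ι) v
    have hindep (τ : κ → ι → B) : Φ (fun k' j => τ k' j + v k') = Φ τ :=
      hΦ fun k' hk' => by simp [v, Pi.single_eq_of_ne hk']
    have hmap := integral_map (μ := exploration κ ι B) hpreserving.measurable.aemeasurable
      (f := fun τ => Φ τ * u (τ k j)) (Measurable.of_discrete).aestronglyMeasurable
    simpa [hpreserving.map_eq, hindep, v] using hmap.symm
  have hsum (τ : κ → ι → B) : ∑ b, u b = ∑ c, u (τ k j + c) :=
    (Equiv.sum_comp (Equiv.addLeft (τ k j)) u).symm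
  calc ∫ τ, Φ τ * ∑ b, u b ∂exploration κ ι B
      = ∫ τ, ∑ c, Φ τ * u (τ k j + c) ∂exploration κ ι B := by
        simp only [← Finset.mul_sum, ← hsum]
    _ = Fintype.card B * ∫ τ, Φ τ * u (τ k j) ∂exploration κ ι B := by
        rw [integral_finsetSum _ fun _ _ => .of_finite, Finset.sum_congr rfl fun c _ => hshift c,
          Finset.sum_const, Finset.card_univ, nsmul_eq_mul]

end Exploration

/-! ### Follow the perturbed leader on block estimates -/

section BlockEstimates

theorem sum_range_mul {M : Type*} [AddCommMonoid M] (f : ℕ → M) (K B : ℕ) :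
    ∑ t ∈ Finset.range (K * B), f t =
      ∑ k ∈ Finset.range K, ∑ b ∈ Finset.range B, f (k * B + b) := by
  induction K with
  | zero => simp
  | succ K ih => rw [Nat.succ_mul, Finset.sum_range_add, ih, Finset.sum_range_succ]

variable {ι : Type*} {K B : ℕ} (x : ℕ → ι → ℝ)

/-- The estimate `r̂_k` formed in block `k`: the `j`-th coordinate is read off in the round in which
`τ` explores object `j`. It is `0` for `k ≥ K`. -/
def blockEstimate (τ : Fin K → ι → Fin B) (k : ℕ) (j : ι) : ℝ :=
  if hk : k < K then x (k * B + τ ⟨k, hk⟩ j) j else 0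

/-- The score `ŝ` after `q` blocks. -/
def blockScore (τ : Fin K → ι → Fin B) (q : ℕ) : ι → ℝ :=
  ∑ k ∈ Finset.range q, blockEstimate x τ k

variable {x}

theorem blockEstimate_mem_Icc {G : ℝ} (hx : ∀ t, x t ∈ Set.Icc 0 fun _ => G)
    (τ : Fin K → ι → Fin B) {k : ℕ} (hk : k < K) :
    blockEstimate x τ k ∈ Set.Icc 0 fun _ => G := by
  constructor <;> intro j <;> rw [blockEstimate, dif_pos hk]
  exacts [(hx _).1 j, (hx _).2 j]

variable (x)

theorem blockScore_apply (τ : Fin K → ι → Fin B) (q : ℕ) (j : ι) :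
    blockScore x τ q j = ∑ k : Fin K, if (k : ℕ) < q then x (k * B + τ k j) j else 0 := by
  have hestimate (k : Fin K) : x (k * B + τ k j) j = blockEstimate x τ k j := by
    simp [blockEstimate]
  simp only [hestimate]
  rw [blockScore, Finset.sum_apply, Fin.sum_univ_eq_sum_range
    (fun k => if k < q then blockEstimate x τ k j else 0), ← Finset.sum_filter]
  refine (Finset.sum_subset (fun k hk => ?_) fun k hk hkK => ?_).symm
  · exact Finset.mem_range.2 (Finset.mem_filter.1 hk).2
  · refine dif_neg fun hlt => hkK ?_
    simpa [hlt] using hk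

theorem dependsOn_blockScore (k : Fin K) :
    DependsOn (fun τ : Fin K → ι → Fin B => blockScore x τ k) {k}ᶜ := by
  intro τ τ' hττ'
  refine Finset.sum_congr rfl fun q hq => funext fun j => ?_
  rw [Finset.mem_range] at hq
  have hqK : q < K := hq.trans k.2
  simp only [blockEstimate, dif_pos hqK]
  rw [hττ' ⟨q, hqK⟩ (Fin.ne_of_lt hq)]

variable [Fintype ι]

theorem integral_dotProduct_blockEstimate (φ : (ι → ℝ) → ι → ℝ) (k : Fin K) :
    ∫ τ, φ (blockScore x τ k) ⬝ᵥ ∑ b ∈ Finset.range B, x (k * B + b)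
        ∂exploration (Fin K) ι (Fin B) =
      B * ∫ τ, φ (blockScore x τ k) ⬝ᵥ blockEstimate x τ k ∂exploration (Fin K) ι (Fin B) := by
  rcases B.eq_zero_or_pos with rfl | hB
  · simp
  have : NeZero B := ⟨hB.ne'⟩
  simp only [dotProduct, Finset.sum_apply, ← Fin.sum_univ_eq_sum_range]
  rw [integral_finsetSum _ fun _ _ => .of_finite, integral_finsetSum _ fun _ _ => .of_finite,
    Finset.mul_sum]
  refine Finset.sum_congr rfl fun i _ => ?_
  have hindep : DependsOn (fun τ : Fin K → ι → Fin B => φ (blockScore x τ k) i) {k}ᶜ :=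
    fun τ τ' h => congrArg (φ · i) (dependsOn_blockScore x k h)
  simpa [blockEstimate] using
    integral_exploration_mul_sum k i hindep fun b : Fin B => x (k * B + b) i

/-- The weights `φ` of a round depend on the earlier blocks only, so the exploration in the current
block gives an unbiased estimate of their gain. -/
theorem integral_sum_dotProduct_blocks (φ : (ι → ℝ) → ι → ℝ) :
    ∫ τ, ∑ t ∈ Finset.range (K * B), φ (blockScore x τ (t / B)) ⬝ᵥ x t
        ∂exploration (Fin K) ι (Fin B) =
      B * ∫ τ, ∑ k ∈ Finset.range K, φ (blockScore x τ k) ⬝ᵥ blockEstimate x τ k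
        ∂exploration (Fin K) ι (Fin B) := by
  have hblocks (τ : Fin K → ι → Fin B) :
      ∑ t ∈ Finset.range (K * B), φ (blockScore x τ (t / B)) ⬝ᵥ x t =
        ∑ k ∈ Finset.range K,
          φ (blockScore x τ k) ⬝ᵥ ∑ b ∈ Finset.range B, x (k * B + b) := by
    rw [sum_range_mul]
    refine Finset.sum_congr rfl fun k _ => ?_
    rw [dotProduct_sum]
    refine Finset.sum_congr rfl fun b hb => ?_
    rw [Finset.mem_range] at hb
    rw [mul_comm k, Nat.mul_add_div (Nat.zero_lt_of_lt hb), Nat.div_eq_of_lt hb, add_zero]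
  simp only [hblocks]
  rw [integral_finsetSum _ fun _ _ => .of_finite, integral_finsetSum _ fun _ _ => .of_finite,
    Finset.mul_sum]
  exact Finset.sum_congr rfl fun k hk =>
    integral_dotProduct_blockEstimate x φ ⟨k, Finset.mem_range.1 hk⟩

variable {x} {D : Set (ι → ℝ)} {w : (ι → ℝ) → ι → ℝ}

theorem IsLinearMaximizer.sum_dotProduct_le_integral_blocks [Nonempty (ι ↪ Fin B)]
    (hw : IsLinearMaximizer D w) (hD : D ⊆ Set.Icc 0 1) (hm : Measurable w) {L : ℝ} (hL : 0 < L)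
    {G : ℝ} (hx : ∀ t, x t ∈ Set.Icc 0 fun _ => G) {y : ι → ℝ} (hy : y ∈ D) :
    ∑ t ∈ Finset.range (K * B), y ⬝ᵥ x t ≤
      ∫ τ, ∑ t ∈ Finset.range (K * B), meanLeader w L (blockScore x τ (t / B)) ⬝ᵥ x t
          ∂exploration (Fin K) ι (Fin B) +
        B * (Fintype.card ι * L + K * ((Fintype.card ι * G) ^ 2 / L)) := by
  have hleader := integral_mono (μ := exploration (Fin K) ι (Fin B)) .of_finite .of_finite
    fun τ => hw.follow_perturbed_leader hD hm hL
      (fun _ hk => blockEstimate_mem_Icc hx τ hk) hy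
  simp only [dotProduct_sum] at hleader
  rw [integral_add .of_finite .of_finite, integral_const, probReal_univ, one_smul] at hleader
  have hfixed := integral_sum_dotProduct_blocks (K := K) (B := B) x fun _ => y
  rw [integral_const, probReal_univ, one_smul] at hfixed
  rw [hfixed, integral_sum_dotProduct_blocks, ← mul_add]
  exact mul_le_mul_of_nonneg_left hleader B.cast_nonneg

end BlockEstimates

/-! ### Regret of RTop-1F -/

section Regret

variable {m n T K : ℕ}

theorem exploreRound_lt_horizon (τ : Fin K → Fin m → Fin (T / K)) (k : Fin K) (j : Fin m) :
    exploreRound τ k j < T :=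
  calc exploreRound τ k j < (k + 1) * (T / K) := by
        rw [exploreRound, add_one_mul]
        exact Nat.add_lt_add_left (τ k j).2 _
    _ ≤ K * (T / K) := Nat.mul_le_mul_right _ k.2
    _ ≤ T := Nat.mul_div_le T K

theorem exploreRound_div (τ : Fin K → Fin m → Fin (T / K)) (k : Fin K) (j : Fin m) :
    exploreRound τ k j / (T / K) = k := by
  have hlt := (τ k j).2
  rw [exploreRound, mul_comm, Nat.mul_add_div (Nat.zero_lt_of_lt hlt), Nat.div_eq_of_lt hlt,
    add_zero]

theorem eq_of_exploreRound_eq {τ : Fin K → Fin m → Fin (T / K)}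
    (hτ : ∀ k, Function.Injective (τ k)) {k k' : Fin K} {j j' : Fin m}
    (h : exploreRound τ k j = exploreRound τ k' j') : j = j' := by
  obtain rfl : k = k' := Fin.ext (by rw [← exploreRound_div τ k j, h, exploreRound_div])
  exact hτ k (Fin.ext (by simpa [exploreRound] using h))

/-- The transformed relevances of all rounds, extended by zero beyond the horizon. -/
noncomputable def transformed (g : Fin (n + 1) → ℝ) (r : Fin T → Relevance m n) : ℕ → Fin m → ℝ :=
  Function.extend Fin.val (fun t j => g (r t j)) 0

theorem transformed_val (g : Fin (n + 1) → ℝ) (r : Fin T → Relevance m n) (t : Fin T) :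
    transformed g r t = fun j => g (r t j) :=
  Fin.val_injective.extend_apply _ _ t

theorem transformed_mem_Icc {g : Fin (n + 1) → ℝ} {G : ℝ} (hg : ∀ v, g v ∈ Set.Icc 0 G)
    (r : Fin T → Relevance m n) (t : ℕ) : transformed g r t ∈ Set.Icc 0 fun _ => G := by
  by_cases ht : t < T
  · rw [← Fin.val_mk ht, transformed_val]
    exact ⟨fun j => (hg _).1, fun j => (hg _).2⟩
  · have hzero : transformed g r t = 0 :=
      Function.extend_apply' _ _ _ fun ⟨s, hs⟩ => ht (hs ▸ s.2)
    rw [hzero]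
    exact ⟨le_rfl, fun _ => (hg 0).1.trans (hg 0).2⟩

open Classical in
/-- The rounds in which some object is explored. -/
noncomputable def exploringRounds (τ : Fin K → Fin m → Fin (T / K)) : Finset (Fin T) :=
  Finset.univ.image fun kj : Fin K × Fin m =>
    ⟨exploreRound τ kj.1 kj.2, exploreRound_lt_horizon τ kj.1 kj.2⟩

theorem card_exploringRounds_le (τ : Fin K → Fin m → Fin (T / K)) :
    (exploringRounds τ).card ≤ K * m :=
  Finset.card_image_le.trans_eq (by simp)

theorem mem_exploringRounds {τ : Fin K → Fin m → Fin (T / K)} {t : Fin T} :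
    t ∈ exploringRounds τ ↔ ∃ kj : Fin K × Fin m, (t : ℕ) = exploreRound τ kj.1 kj.2 := by
  simp [exploringRounds, Fin.ext_iff, eq_comm]

theorem ArgminRule.integrable_dotProduct (M : ArgminRule m) {Ω : Type*} [MeasurableSpace Ω]
    {μ : Measure Ω} [IsFiniteMeasure μ] {X : Ω → Fin m → ℝ} (hX : Measurable X) (v : Fin m → ℝ) :
    Integrable (fun ω => discountVector (M.toFun (X ω)) ⬝ᵥ v) μ := by
  let _ : MeasurableSpace (Equiv.Perm (Fin m)) := ⊤
  exact (Integrable.of_finite (f := fun σ => discountVector σ ⬝ᵥ v)).comp_measurable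
    ((measurable_to_countable' fun σ => M.measurable σ).comp hX)

theorem measurable_score_add_perturbation (y : (Fin K → Fin m → Fin (T / K)) → Fin m → ℝ)
    (t : Fin T) : Measurable fun ω : Randomness m T K => y ω.1 + ω.2 t :=
  (Measurable.of_discrete.comp measurable_fst).add ((measurable_pi_apply t).comp measurable_snd)

theorem ArgminRule.integral_randomness_dotProduct (M : ArgminRule m) {ε : ℝ} (hε : 0 < ε)
    (y : (Fin K → Fin m → Fin (T / K)) → Fin m → ℝ) (t : Fin T) (v : Fin m → ℝ) :
    ∫ ω, discountVector (M.toFun (y ω.1 + ω.2 t)) ⬝ᵥ v ∂randomness m T K ε =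
      ∫ τ, meanLeader (fun y => discountVector (M.toFun y)) (1 / ε) (y τ) ⬝ᵥ v
        ∂exploration (Fin K) (Fin m) (Fin (T / K)) := by
  have hL : 0 < 1 / ε := by positivity
  have := isProbabilityMeasure_uniformCube (Fin m) hL
  change ∫ ω, _ ∂(exploration (Fin K) (Fin m) (Fin (T / K))).prod
    (Measure.pi fun _ : Fin T => uniformCube (Fin m) (1 / ε)) = _
  rw [integral_prod _ (M.integrable_dotProduct (measurable_score_add_perturbation y t) v)]
  refine integral_congr_ae (.of_forall fun τ => ?_)
  have heval := measurePreserving_eval (fun _ : Fin T => uniformCube (Fin m) (1 / ε)) t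
  have hmap := integral_map (μ := Measure.pi fun _ : Fin T => uniformCube (Fin m) (1 / ε))
    heval.measurable.aemeasurable
    (M.integrable_dotProduct (measurable_const_add (y τ)) v).aestronglyMeasurable
  rw [heval.map_eq] at hmap
  exact hmap.symm.trans (M.isLinearMaximizer.meanLeader_dotProduct range_discountVector_subset
    M.measurable_discountVector hL _ _).symm

theorem sum_dotProduct_le_sum_blocks_add {ι : Type*} [Fintype ι] {x : ℕ → ι → ℝ} {G : ℝ}
    (hx : ∀ t, x t ∈ Set.Icc 0 fun _ => G) {y : ι → ℝ} (hy : y ∈ Set.Icc 0 1) (hK : 0 < K) :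
    ∑ t : Fin T, y ⬝ᵥ x t ≤
      ∑ t ∈ Finset.range (K * (T / K)), y ⬝ᵥ x t + K * (Fintype.card ι * G) := by
  have hgain (t : ℕ) := dotProduct_mem_Icc hy (hx t)
  have hG : 0 ≤ Fintype.card ι * G := (hgain 0).1.trans (hgain 0).2
  rw [Fin.sum_univ_eq_sum_range fun t => y ⬝ᵥ x t]
  nth_rewrite 1 [← Nat.div_add_mod T K]
  rw [Finset.sum_range_add]
  gcongr
  calc ∑ s ∈ Finset.range (T % K), y ⬝ᵥ x (K * (T / K) + s)
      ≤ (T % K : ℕ) * (Fintype.card ι * G) := by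
        simpa using Finset.sum_le_card_nsmul (Finset.range (T % K)) _ _ fun s _ =>
          (hgain (K * (T / K) + s)).2
    _ ≤ K * (Fintype.card ι * G) := by
        gcongr
        exact (Nat.mod_lt T hK).le

theorem ArgminRule.integral_sum_randomness_dotProduct (M : ArgminRule m) {ε : ℝ} (hB : m ≤ T / K)
    (hε : 0 < ε) (x : ℕ → Fin m → ℝ) :
    ∫ ω, ∑ t : Fin T, discountVector (M.toFun (blockScore x ω.1 (t / (T / K)) + ω.2 t)) ⬝ᵥ x t
        ∂randomness m T K ε =
      ∫ τ, ∑ t ∈ Finset.range T, meanLeader (fun y => discountVector (M.toFun y)) (1 / ε)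
        (blockScore x τ (t / (T / K))) ⬝ᵥ x t ∂exploration (Fin K) (Fin m) (Fin (T / K)) := by
  have := isProbabilityMeasure_randomness hB hε
  simp only [← Fin.sum_univ_eq_sum_range]
  rw [integral_finsetSum _ fun (t : Fin T) _ => M.integrable_dotProduct
      (measurable_score_add_perturbation (fun τ => blockScore x τ (t / (T / K))) t) _,
    integral_finsetSum _ fun _ _ => .of_finite]
  exact Finset.sum_congr rfl fun t _ =>
    M.integral_randomness_dotProduct hε (fun τ => blockScore x τ (t / (T / K))) t _

theorem ArgminRule.sum_dotProduct_le_integral_randomness (M : ArgminRule m) {x : ℕ → Fin m → ℝ}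
    {G ε : ℝ} (hx : ∀ t, x t ∈ Set.Icc 0 fun _ => G) (hε : 0 < ε) (hB : m ≤ T / K) (hK : 0 < K)
    (σ : Equiv.Perm (Fin m)) :
    ∑ t : Fin T, discountVector σ ⬝ᵥ x t ≤
      ∫ ω, ∑ t : Fin T, discountVector (M.toFun (blockScore x ω.1 (t / (T / K)) + ω.2 t)) ⬝ᵥ x t
          ∂randomness m T K ε +
        ((T / K : ℕ) * (m / ε + ε * K * (m * G) ^ 2) + K * (m * G)) := by
  have : Nonempty (Fin m ↪ Fin (T / K)) := ⟨Fin.castLEEmb hB⟩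
  have hblocks := M.isLinearMaximizer.sum_dotProduct_le_integral_blocks (K := K) (B := T / K)
    range_discountVector_subset M.measurable_discountVector (one_div_pos.2 hε) hx
    (Set.mem_range_self σ)
  have hhorizon : ∫ τ, ∑ t ∈ Finset.range (K * (T / K)), meanLeader
          (fun y => discountVector (M.toFun y)) (1 / ε) (blockScore x τ (t / (T / K))) ⬝ᵥ x t
        ∂exploration (Fin K) (Fin m) (Fin (T / K)) ≤
      ∫ τ, ∑ t ∈ Finset.range T, meanLeader
          (fun y => discountVector (M.toFun y)) (1 / ε) (blockScore x τ (t / (T / K))) ⬝ᵥ x t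
        ∂exploration (Fin K) (Fin m) (Fin (T / K)) := by
    refine integral_mono .of_finite .of_finite fun τ =>
      Finset.sum_le_sum_of_subset_of_nonneg (Finset.range_subset_range.2 (Nat.mul_div_le T K))
        fun t _ _ => Finset.sum_nonneg fun i _ => mul_nonneg ?_ ((hx t).1 i)
    exact integral_nonneg fun q => (discountVector_mem_Icc _).1 i
  have hleftover := sum_dotProduct_le_sum_blocks_add hx (discountVector_mem_Icc σ) hK (T := T)
  rw [Fintype.card_fin] at hblocks hleftover
  rw [M.integral_sum_randomness_dotProduct hB hε]
  have hconst : m * (1 / ε) + K * ((m * G) ^ 2 / (1 / ε)) = m / ε + ε * K * (m * G) ^ 2 := by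
    field_simp
  rw [hconst] at hblocks
  linarith

variable [NeZero m] {g : Fin (n + 1) → ℝ} {M : ArgminRule m}
  {explore : Fin T → Fin m → Equiv.Perm (Fin m)} {ω : Randomness m T K}

theorem feedback_exploreRound (hexp : ∀ t j, topObject (explore t j) = j)
    (hω : ∀ k, Function.Injective (ω.1 k)) (r : Fin T → Relevance m n) (k : Fin K) (j : Fin m) :
    feedback (rtop1fAct g M explore ω) r
        ⟨exploreRound ω.1 k j, exploreRound_lt_horizon ω.1 k j⟩ =
      r ⟨exploreRound ω.1 k j, exploreRound_lt_horizon ω.1 k j⟩ j := by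
  have hexploring : ∃ kj : Fin K × Fin m, exploreRound ω.1 k j = exploreRound ω.1 kj.1 kj.2 :=
    ⟨(k, j), rfl⟩
  rw [feedback_eq, played, rtop1fAct, dif_pos hexploring, hexp,
    ← eq_of_exploreRound_eq hω hexploring.choose_spec]

theorem score_feedback_eq (hexp : ∀ t j, topObject (explore t j) = j)
    (hω : ∀ k, Function.Injective (ω.1 k)) (r : Fin T → Relevance m n) (t : Fin T) :
    score g ω.1 t (fun s => feedback (rtop1fAct g M explore ω) r ⟨s, s.2.trans t.2⟩) =
      blockScore (transformed g r) ω.1 (t / (T / K)) := by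
  funext j
  rw [blockScore_apply, score]
  refine Finset.sum_congr rfl fun k _ => ?_
  split_ifs
  · rw [feedback_exploreRound hexp hω]
    exact (congrFun (transformed_val g r ⟨exploreRound ω.1 k j, _⟩) j).symm
  · rfl

theorem played_of_notMem_exploringRounds (hexp : ∀ t j, topObject (explore t j) = j)
    (hω : ∀ k, Function.Injective (ω.1 k)) (r : Fin T → Relevance m n) {t : Fin T}
    (ht : t ∉ exploringRounds ω.1) :
    played (rtop1fAct g M explore ω) r t =
      M.toFun (blockScore (transformed g r) ω.1 (t / (T / K)) + ω.2 t) := by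
  rw [mem_exploringRounds] at ht
  rw [played, rtop1fAct, dif_neg ht, score_feedback_eq hexp hω]

theorem sum_leader_dotProduct_le {G : ℝ} (hg : ∀ v, g v ∈ Set.Icc 0 G)
    (hexp : ∀ t j, topObject (explore t j) = j) (hω : ∀ k, Function.Injective (ω.1 k))
    (r : Fin T → Relevance m n) :
    ∑ t : Fin T, discountVector (M.toFun (blockScore (transformed g r) ω.1 (t / (T / K)) + ω.2 t))
        ⬝ᵥ transformed g r t ≤
      ∑ t : Fin T, discountVector (played (rtop1fAct g M explore ω) r t) ⬝ᵥ transformed g r t +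
        K * m * (m * G) := by
  classical
  have hgain (σ : Equiv.Perm (Fin m)) (t : ℕ) :
      discountVector σ ⬝ᵥ transformed g r t ∈ Set.Icc 0 (m * G) := by
    simpa using dotProduct_mem_Icc (discountVector_mem_Icc σ) (transformed_mem_Icc hg r t)
  have hround (t : Fin T) :
      discountVector (M.toFun (blockScore (transformed g r) ω.1 (t / (T / K)) + ω.2 t))
          ⬝ᵥ transformed g r t ≤
        discountVector (played (rtop1fAct g M explore ω) r t) ⬝ᵥ transformed g r t +
          if t ∈ exploringRounds ω.1 then m * G else 0 := by
    split_ifs with ht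
    · linarith [(hgain (M.toFun (blockScore (transformed g r) ω.1 (t / (T / K)) + ω.2 t)) t).2,
        (hgain (played (rtop1fAct g M explore ω) r t) t).1]
    · rw [played_of_notMem_exploringRounds hexp hω r ht, add_zero]
  refine (Finset.sum_le_sum fun t _ => hround t).trans ?_
  rw [Finset.sum_add_distrib, Finset.sum_ite_mem, Finset.univ_inter, Finset.sum_const,
    nsmul_eq_mul]
  have hG : 0 ≤ m * G := (hgain 1 0).1.trans (hgain 1 0).2
  gcongr
  exact_mod_cast card_exploringRounds_le ω.1

theorem ae_injective_randomness (m T K : ℕ) (ε : ℝ) :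
    ∀ᵐ ω ∂randomness m T K ε, ∀ k, Function.Injective (ω.1 k) :=
  Measure.quasiMeasurePreserving_fst.ae (ae_injective_exploration (Fin K) (Fin m) (Fin (T / K)))

theorem regret_rtop1f_le {G ε : ℝ} (hg : ∀ v, g v ∈ Set.Icc 0 G)
    (hexp : ∀ t j, topObject (explore t j) = j) (hK : 0 < K) (hB : m ≤ T / K) (hε : 0 < ε)
    {gain : Equiv.Perm (Fin m) → Relevance m n → ℝ}
    (hgain : ∀ σ r, gain σ r = discountVector σ ⬝ᵥ fun i => g (r i))
    (r : Fin T → Relevance m n) :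
    regret (rtop1f g M explore K ε hB hε) gain r ≤
      (T / K : ℕ) * (m / ε + ε * K * (m * G) ^ 2) + K * m * (m * G) + K * (m * G) := by
  have := isProbabilityMeasure_randomness hB hε
  have hleader (t : Fin T) : Integrable (fun ω : Randomness m T K => discountVector
      (M.toFun (blockScore (transformed g r) ω.1 (t / (T / K)) + ω.2 t)) ⬝ᵥ transformed g r t)
      (randomness m T K ε) :=
    M.integrable_dotProduct
      (measurable_score_add_perturbation (blockScore (transformed g r) · (t / (T / K))) t) _
  have hplayed : Integrable (fun ω => ∑ t : Fin T,
      discountVector (played (rtop1fAct g M explore ω) r t) ⬝ᵥ transformed g r t)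
      (randomness m T K ε) :=
    integrable_finsetSum _ fun t _ => integrable_played (rtop1f g M explore K ε hB hε) r t
      fun σ => discountVector σ ⬝ᵥ transformed g r t
  have hexploration := integral_mono_ae (integrable_finsetSum _ fun t _ => hleader t)
    (hplayed.add (integrable_const (K * m * (m * G))))
    ((ae_injective_randomness m T K ε).mono fun ω hω => sum_leader_dotProduct_le hg hexp hω r)
  rw [integral_add' hplayed (integrable_const _), integral_const, probReal_univ, one_smul]
    at hexploration
  simp only [regret, hgain, ← transformed_val g r]
  rw [sub_le_iff_le_add]
  refine Finset.sup'_le _ _ fun σ _ => ?_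
  have hbest := M.sum_dotProduct_le_integral_randomness (transformed_mem_Icc hg r) hε hB hK σ
  change _ ≤ _ + ∫ ω, ∑ t : Fin T,
    discountVector (played (rtop1fAct g M explore ω) r t) ⬝ᵥ transformed g r t ∂randomness m T K ε
  linarith

end Regret

/-! ### Tuning of RTop-1F -/

section Tuning

variable {m T : ℕ}

theorem rpow_third_pow {x : ℝ} (hx : 0 ≤ x) (k : ℕ) :
    (x ^ (1 / 3 : ℝ)) ^ k = x ^ ((k : ℝ) / 3) := by
  rw [← Real.rpow_mul_natCast hx, one_div_mul_eq_div]

theorem numBlocks_pos (hm : 1 ≤ m) (hB : m ≤ T / numBlocks m T) : 0 < numBlocks m T := by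
  by_contra! hzero
  rw [Nat.le_zero.1 hzero, Nat.div_zero] at hB
  omega

theorem tuning_pos {G : ℝ} (hG : 0 < G) (hm : 1 ≤ m) (hB : m ≤ T / numBlocks m T) :
    0 < √(1 / (G ^ 2 * m * numBlocks m T)) := by
  have hK := numBlocks_pos hm hB
  positivity

theorem numBlocks_eq_floor (m T : ℕ) :
    numBlocks m T = ⌊(T : ℝ) ^ (2 / 3 : ℝ) / (m : ℝ) ^ (1 / 3 : ℝ)⌋₊ := by
  rw [numBlocks, Real.rpow_neg m.cast_nonneg, mul_comm, ← div_eq_mul_inv]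

theorem numBlocks_mul_le (hm : 1 ≤ m) (T : ℕ) :
    numBlocks m T * (m : ℝ) ^ (1 / 3 : ℝ) ≤ (T : ℝ) ^ (2 / 3 : ℝ) := by
  rw [← le_div_iff₀ (by positivity), numBlocks_eq_floor]
  exact Nat.floor_le (by positivity)

theorem le_two_mul_numBlocks_mul (hm : 1 ≤ m) (hK : 0 < numBlocks m T) :
    (T : ℝ) ^ (2 / 3 : ℝ) ≤ 2 * numBlocks m T * (m : ℝ) ^ (1 / 3 : ℝ) := by
  rw [← div_le_iff₀ (by positivity)]
  have hone : (1 : ℝ) ≤ numBlocks m T := by exact_mod_cast hK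
  calc (T : ℝ) ^ (2 / 3 : ℝ) / (m : ℝ) ^ (1 / 3 : ℝ) ≤ numBlocks m T + 1 := by
        rw [numBlocks_eq_floor]
        exact (Nat.lt_floor_add_one _).le
    _ ≤ 2 * numBlocks m T := by linarith

theorem le_div_numBlocks (hm : 1 ≤ m) (hT : m ^ 2 ≤ T) : m ≤ T / numBlocks m T := by
  have hm0 : (0 : ℝ) < m := by exact_mod_cast hm
  have hT' : (m : ℝ) ^ (2 : ℝ) ≤ T := by exact_mod_cast hT
  have hfactor : (m : ℝ) ^ (2 / 3 : ℝ) ≤ (T : ℝ) ^ (1 / 3 : ℝ) := by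
    calc (m : ℝ) ^ (2 / 3 : ℝ) = ((m : ℝ) ^ (2 : ℝ)) ^ (1 / 3 : ℝ) := by
          rw [← Real.rpow_mul hm0.le]; norm_num
      _ ≤ (T : ℝ) ^ (1 / 3 : ℝ) := by gcongr
  have hK : 0 < numBlocks m T := by
    rw [numBlocks_eq_floor, Nat.floor_pos, one_le_div₀ (by positivity)]
    have hmT : m ≤ T := (Nat.le_self_pow two_ne_zero m).trans hT
    calc (m : ℝ) ^ (1 / 3 : ℝ) ≤ (m : ℝ) ^ (2 / 3 : ℝ) := by
          gcongr
          · exact_mod_cast hm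
          · norm_num
      _ ≤ (T : ℝ) ^ (2 / 3 : ℝ) := by gcongr
  rw [Nat.le_div_iff_mul_le hK, ← Nat.cast_le (α := ℝ), Nat.cast_mul]
  calc (m : ℝ) * numBlocks m T
      = (m : ℝ) ^ (2 / 3 : ℝ) * (numBlocks m T * (m : ℝ) ^ (1 / 3 : ℝ)) := by
        rw [mul_left_comm, ← Real.rpow_add hm0, mul_comm]
        norm_num
    _ ≤ (T : ℝ) ^ (1 / 3 : ℝ) * (T : ℝ) ^ (2 / 3 : ℝ) := by
        gcongr
        exact numBlocks_mul_le hm T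
    _ = T := by
        rw [← Real.rpow_add' T.cast_nonneg (by norm_num)]
        norm_num

theorem div_add_mul_tuning_eq {G K μ : ℝ} (hG : 0 < G) (hμ : 0 < μ) (hK : 0 < K) :
    μ / √(1 / (G ^ 2 * μ * K)) + √(1 / (G ^ 2 * μ * K)) * K * (μ * G) ^ 2 =
      2 * μ * G * √(μ * K) := by
  have hε : √(1 / (G ^ 2 * μ * K)) = 1 / (G * √(μ * K)) := by
    rw [mul_assoc, Real.sqrt_div zero_le_one, Real.sqrt_one, Real.sqrt_mul (sq_nonneg G),
      Real.sqrt_sq hG.le]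
  have hsq : √(μ * K) ^ 2 = μ * K := Real.sq_sqrt (by positivity)
  rw [hε]
  field_simp
  rw [hsq]
  ring

theorem div_numBlocks_mul_sqrt_le (hm : 1 ≤ m) (hK : 0 < numBlocks m T) :
    (T / numBlocks m T : ℕ) * √(m * numBlocks m T) ≤
      2 * (m : ℝ) ^ (2 / 3 : ℝ) * (T : ℝ) ^ (2 / 3 : ℝ) := by
  have hT : (T : ℝ) ^ (2 / 3 : ℝ) ≤ _ := le_two_mul_numBlocks_mul hm hK
  have hfloor : ((T / numBlocks m T : ℕ) : ℝ) * numBlocks m T ≤ T := by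
    exact_mod_cast Nat.div_mul_le_self T _
  have hm2 := rpow_third_pow m.cast_nonneg (x := m) 2
  have hm3 := rpow_third_pow m.cast_nonneg (x := m) 3
  have hT2 := rpow_third_pow T.cast_nonneg (x := T) 2
  have hT3 := rpow_third_pow T.cast_nonneg (x := T) 3
  simp only [Nat.cast_ofNat, div_self (three_ne_zero' ℝ), Real.rpow_one] at hm2 hm3 hT2 hT3
  have hT0 : 0 < T := Nat.pos_of_ne_zero (by rintro rfl; simp [numBlocks] at hK)
  set a : ℝ := (m : ℝ) ^ (1 / 3 : ℝ)
  set b : ℝ := (T : ℝ) ^ (1 / 3 : ℝ)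
  have ha : 0 ≤ a := by positivity
  have hb : 0 < b := by positivity
  rw [← hm2, ← hT2]
  rw [← hT2] at hT
  have hsqrt : √(m * numBlocks m T) * b ≤ 2 * a ^ 2 * numBlocks m T := by
    rw [← sq_le_sq₀ (by positivity) (by positivity), mul_pow, Real.sq_sqrt (by positivity), ← hm3]
    calc a ^ 3 * numBlocks m T * b ^ 2
        ≤ a ^ 3 * numBlocks m T * (2 * numBlocks m T * a) := by gcongr
      _ ≤ (2 * a ^ 2 * numBlocks m T) ^ 2 := by
          linear_combination (2 : ℝ) * sq_nonneg (a ^ 2 * numBlocks m T)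
  refine le_of_mul_le_mul_right ?_ hb
  calc (T / numBlocks m T : ℕ) * √(m * numBlocks m T) * b
      = (T / numBlocks m T : ℕ) * (√(m * numBlocks m T) * b) := by ring
    _ ≤ (T / numBlocks m T : ℕ) * (2 * a ^ 2 * numBlocks m T) := by gcongr
    _ = 2 * a ^ 2 * ((T / numBlocks m T : ℕ) * numBlocks m T) := by ring
    _ ≤ 2 * a ^ 2 * b ^ 3 := by
        rw [hT3]
        gcongr
    _ = 2 * a ^ 2 * b ^ 2 * b := by ring

theorem rtop1f_bound_tuned_le {G : ℝ} (hG : 0 < G) (hm : 1 ≤ m) (hB : m ≤ T / numBlocks m T) :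
    (T / numBlocks m T : ℕ) * (m / √(1 / (G ^ 2 * m * numBlocks m T)) +
        √(1 / (G ^ 2 * m * numBlocks m T)) * numBlocks m T * (m * G) ^ 2) +
      numBlocks m T * m * (m * G) + numBlocks m T * (m * G) ≤
      6 * (G * (m : ℝ) ^ (5 / 3 : ℝ) * (T : ℝ) ^ (2 / 3 : ℝ)) := by
  have hK := numBlocks_pos hm hB
  have hm1 : (1 : ℝ) ≤ m := by exact_mod_cast hm
  have hm0 : (0 : ℝ) < m := by linarith
  rw [div_add_mul_tuning_eq hG hm0 (by exact_mod_cast hK)]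
  have hsplit : (m : ℝ) * (m : ℝ) ^ (2 / 3 : ℝ) = (m : ℝ) ^ (5 / 3 : ℝ) := by
    rw [← Real.rpow_one_add' hm0.le (by norm_num)]
    norm_num
  have hsq : (m : ℝ) ^ (5 / 3 : ℝ) * (m : ℝ) ^ (1 / 3 : ℝ) = m * m := by
    rw [← Real.rpow_add hm0, ← sq]
    norm_num
  have hpredict : (T / numBlocks m T : ℕ) * (2 * m * G * √(m * numBlocks m T)) ≤
      4 * (G * (m : ℝ) ^ (5 / 3 : ℝ) * (T : ℝ) ^ (2 / 3 : ℝ)) := by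
    calc (T / numBlocks m T : ℕ) * (2 * m * G * √(m * numBlocks m T))
        = 2 * G * m * ((T / numBlocks m T : ℕ) * √(m * numBlocks m T)) := by ring
      _ ≤ 2 * G * m * (2 * (m : ℝ) ^ (2 / 3 : ℝ) * (T : ℝ) ^ (2 / 3 : ℝ)) := by
          exact mul_le_mul_of_nonneg_left (div_numBlocks_mul_sqrt_le hm hK) (by positivity)
      _ = _ := by rw [← hsplit]; ring
  have hexplore : numBlocks m T * m * (m * G) ≤
      G * (m : ℝ) ^ (5 / 3 : ℝ) * (T : ℝ) ^ (2 / 3 : ℝ) := by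
    calc numBlocks m T * m * (m * G)
        = G * (m : ℝ) ^ (5 / 3 : ℝ) * (numBlocks m T * (m : ℝ) ^ (1 / 3 : ℝ)) := by
          linear_combination -(numBlocks m T * G) * hsq
      _ ≤ _ := by
          gcongr
          exact numBlocks_mul_le hm T
  have hleftover : (numBlocks m T : ℝ) * (m * G) ≤ numBlocks m T * m * (m * G) := by
    gcongr
    exact le_mul_of_one_le_right (Nat.cast_nonneg _) hm1
  linarith

variable {n : ℕ} [NeZero m] {M : ArgminRule m} {explore : Fin T → Fin m → Equiv.Perm (Fin m)}

theorem regret_rtop1f_dcg_le (hn : 1 ≤ n) (hB : m ≤ T / numBlocks m T)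
    (hε : 0 < √(1 / (((2 : ℝ) ^ n - 1) ^ 2 * m * numBlocks m T)))
    (hexp : ∀ t j, topObject (explore t j) = j) (r : Fin T → Relevance m n) :
    regret (rtop1f (fun v : Fin (n + 1) => (2 : ℝ) ^ (v : ℕ) - 1) M explore (numBlocks m T)
        (√(1 / (((2 : ℝ) ^ n - 1) ^ 2 * m * numBlocks m T))) hB hε) dcg r ≤
      6 * (((2 : ℝ) ^ n - 1) * (m : ℝ) ^ (5 / 3 : ℝ) * (T : ℝ) ^ (2 / 3 : ℝ)) := by
  have hm : 1 ≤ m := NeZero.one_le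
  refine (regret_rtop1f_le (G := 2 ^ n - 1) (fun v => ⟨?_, ?_⟩) hexp (numBlocks_pos hm hB) hB hε
    dcg_eq_dotProduct r).trans (rtop1f_bound_tuned_le (two_pow_sub_one_pos hn) hm hB)
  · exact sub_nonneg.2 (one_le_pow₀ one_le_two)
  · exact sub_le_sub_right (pow_le_pow_right₀ one_le_two (Nat.le_of_lt_succ v.2)) _

theorem regret_rtop1f_binaryDCG_le (hB : m ≤ T / numBlocks m T)
    (hε : 0 < √(1 / ((m : ℝ) * numBlocks m T)))
    (hexp : ∀ t j, topObject (explore t j) = j) (r : Fin T → Relevance m 1) :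
    regret (rtop1f (fun v : Fin (1 + 1) => ((v : ℕ) : ℝ)) M explore (numBlocks m T)
        (√(1 / ((m : ℝ) * numBlocks m T))) hB hε) binaryDCG r ≤
      6 * ((m : ℝ) ^ (5 / 3 : ℝ) * (T : ℝ) ^ (2 / 3 : ℝ)) := by
  have hm : 1 ≤ m := NeZero.one_le
  have htuned := rtop1f_bound_tuned_le one_pos hm hB
  simp only [one_pow, one_mul] at htuned
  refine (regret_rtop1f_le (G := 1) (fun v => ⟨Nat.cast_nonneg _, ?_⟩) hexp (numBlocks_pos hm hB)
    hB hε binaryDCG_eq_dotProduct r).trans htuned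
  exact_mod_cast Nat.le_of_lt_succ v.2

end Tuning

end TopOne

theorem mainTheorem4 :
    -- Regret of RTop-1F for DCG with relevance levels `{0, …, n}`.
    (∃ C : ℝ, 0 < C ∧ ∀ (m n T : ℕ) [NeZero m], 1 ≤ n →
      ∀ hB : m ≤ T / TopOne.numBlocks m T,
      ∃ hε : 0 < √(1 / (((2 : ℝ) ^ n - 1) ^ 2 * m * TopOne.numBlocks m T)),
      ∀ (M : TopOne.ArgminRule m) (explore : Fin T → Fin m → Equiv.Perm (Fin m)),
      (∀ t j, TopOne.topObject (explore t j) = j) →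
      ∀ r : Fin T → TopOne.Relevance m n,
        TopOne.regret
            (TopOne.rtop1f (fun v : Fin (n + 1) => (2 : ℝ) ^ (v : ℕ) - 1) M explore
              (TopOne.numBlocks m T)
              (√(1 / (((2 : ℝ) ^ n - 1) ^ 2 * m * TopOne.numBlocks m T))) hB hε)
            TopOne.dcg r
          ≤ C * (((2 : ℝ) ^ n - 1) * (m : ℝ) ^ (5 / 3 : ℝ) * (T : ℝ) ^ (2 / 3 : ℝ))) ∧
    -- Binary relevance: the algorithm runs on the untransformed relevances.
    (∃ C : ℝ, 0 < C ∧ ∀ (m T : ℕ) [NeZero m],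
      ∀ hB : m ≤ T / TopOne.numBlocks m T,
      ∃ hε : 0 < √(1 / ((m : ℝ) * TopOne.numBlocks m T)),
      ∀ (M : TopOne.ArgminRule m) (explore : Fin T → Fin m → Equiv.Perm (Fin m)),
      (∀ t j, TopOne.topObject (explore t j) = j) →
      ∀ r : Fin T → TopOne.Relevance m 1,
        TopOne.regret
            (TopOne.rtop1f (fun v : Fin (1 + 1) => ((v : ℕ) : ℝ)) M explore
              (TopOne.numBlocks m T)
              (√(1 / ((m : ℝ) * TopOne.numBlocks m T))) hB hε)
            TopOne.binaryDCG r
          ≤ C * ((m : ℝ) ^ (5 / 3 : ℝ) * (T : ℝ) ^ (2 / 3 : ℝ))) ∧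
    -- The blocks are long enough for the algorithm to run as soon as `T ≥ m ^ 2`.
    (∀ m T : ℕ, 1 ≤ m → m ^ 2 ≤ T → m ≤ T / TopOne.numBlocks m T) ∧
    -- Local observability fails.
    (∀ (m n : ℕ) [NeZero m], 3 ≤ m → 1 ≤ n → ¬ TopOne.LocallyObservable m n) ∧
    -- Lower bound for every learner.
    (∃ c : ℝ, 0 < c ∧ ∀ (m n T : ℕ) [NeZero m], 3 ≤ m → 1 ≤ n →
      ∀ L : TopOne.Learner m n T, ∃ r : Fin T → TopOne.Relevance m n,
        c * (T : ℝ) ^ (2 / 3 : ℝ) ≤ TopOne.regret L TopOne.dcg r) := by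
  refine ⟨⟨6, by norm_num, fun m n T _ hn hB => ?_⟩, ⟨6, by norm_num, fun m T _ hB => ?_⟩,
    fun m T => TopOne.le_div_numBlocks, fun m n _ => TopOne.not_locallyObservable,
    ⟨1 / 64, by norm_num, fun m n T _ hm hn L => TopOne.exists_regret_dcg_ge hm hn L⟩⟩
  · have hε := TopOne.tuning_pos (TopOne.two_pow_sub_one_pos hn) NeZero.one_le hB
    exact ⟨hε, fun M explore hexp => TopOne.regret_rtop1f_dcg_le hn hB hε hexp⟩
  · have hε := TopOne.tuning_pos one_pos NeZero.one_le hB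
    rw [one_pow, one_mul] at hε
    exact ⟨hε, fun M explore hexp => TopOne.regret_rtop1f_binaryDCG_le hB hε hexp⟩
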